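/- **Proposition 3.1 (De Giorgi's First Lemma).** Let $n\ge 1$ be an integer and let $\Lambda>0$, $p>2$ and $m>1+\frac{\max(n,2)}{p}$ be real numbers. Write $B_r=\{x\in\mathbb{R}^n:|x|<r\}$, $\overline{Q}_2=[-2,0]\times B_2$ and $Q_1=[-1,0]\times B_1$. There exists a constant $\delta_0>0$, depending only on $\Lambda$, $p$, $m$ and $n$, with the following property. Let $A\in L^\infty(\overline{Q}_2;\mathbb{R}^{n\times n})$ with $\|A\|_\infty\le\Lambda$ (essential supremum of the Euclidean operator norm; $A$ need be neither symmetric nor positive), let $f\in L^m(\overline{Q}_2)$ with $\|f\|_{L^m(\overline{Q}_2)}\le\Lambda$, and let $u\in L^p(\overline{Q}_2)$ have a weak spatial gradient $\nabla u\in L^p(\overline{Q}_2;\mathbb{R}^n)$ and satisfy $$\partial_t u+\Lambda^{-1}|\nabla u|^p-\operatorname{div}(A\nabla u)\le f$$ in the sense of distributions on $\overline{Q}_2$, that is, $$-\iint_{\overline{Q}_2} u\,\partial_t\varphi+\Lambda^{-1}\iint_{\overline{Q}_2}|\nabla u|^p\varphi+\iint_{\overline{Q}_2}(A\nabla u)\cdot\nabla\varphi\le\iint_{\overline{Q}_2}f\varphi$$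 for every nonnegative $\varphi\in C_c^\infty((-2,0)\times B_2)$. If $$u(t,x)\le 1\ \text{ for a.e. }(t,x)\in\overline{Q}_2\qquad\text{and}\qquad \big|\{u>0\}\cap\overline{Q}_2\big|\le\delta_0,$$ then $$u(t,x)\le\tfrac12\quad\text{for a.e. }(t,x)\in Q_1.$$ -/

import Mathlib

open MeasureTheory Set Metric
open scoped ContDiff ENNReal

noncomputable section

namespace SuperquadraticHJ

/-- The Euclidean space `ℝⁿ`. -/
abbrev E (n : ℕ) : Type := EuclideanSpace ℝ (Fin n)

/-- The cylinder `[-τ, 0] × B_r ⊆ ℝ × ℝⁿ`, with `B_r` the open ball of radius `r` centred at the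
origin. Points are pairs `(t, x)`; the measure `volume` on `ℝ × ℝⁿ` is Lebesgue measure. -/
def cylinder (n : ℕ) (τ r : ℝ) : Set (ℝ × E n) :=
  Icc (-τ) 0 ×ˢ ball (0 : E n) r

/-- `φ` is a smooth function with compact support contained in the interior of `Q`. -/
structure IsTestFunction {n : ℕ} (Q : Set (ℝ × E n)) (φ : ℝ × E n → ℝ) : Prop where
  contDiff : ContDiff ℝ ∞ φ
  hasCompactSupport : HasCompactSupport φ
  tsupport_subset : tsupport φ ⊆ interior Q

/-- The time derivative `∂ₜφ` at the point `z = (t, x)`. -/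
def timeDeriv {n : ℕ} (φ : ℝ × E n → ℝ) (z : ℝ × E n) : ℝ :=
  fderiv ℝ φ z (1, 0)

/-- The derivative `e · ∇φ` of `φ` at `z = (t, x)` in the spatial direction `e`. -/
def spaceDeriv {n : ℕ} (φ : ℝ × E n → ℝ) (z : ℝ × E n) (e : E n) : ℝ :=
  fderiv ℝ φ z (0, e)

/-- `Du` is the weak (distributional) spatial gradient of `u` on the interior of `Q`. -/
def IsWeakSpatialGradient {n : ℕ} (Q : Set (ℝ × E n)) (u : ℝ × E n → ℝ)
    (Du : ℝ × E n → E n) : Prop :=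
  ∀ φ : ℝ × E n → ℝ, IsTestFunction Q φ → ∀ e : E n,
    ∫ z in Q, u z * spaceDeriv φ z e = - ∫ z in Q, inner ℝ (Du z) e * φ z

/-- The action `M v` of a square matrix on a Euclidean vector. -/
def matAct {n : ℕ} (M : Matrix (Fin n) (Fin n) ℝ) : E n →L[ℝ] E n :=
  Matrix.toEuclideanCLM (n := Fin n) (𝕜 := ℝ) M

/-- `A ∈ L^∞(Q; ℝ^{n×n})` with `‖A‖_∞ ≤ Λ`; matrices carry the Euclidean operator norm. -/
def MatrixBound {n : ℕ} (Λ : ℝ) (Q : Set (ℝ × E n))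
    (A : ℝ × E n → Matrix (Fin n) (Fin n) ℝ) : Prop :=
  AEStronglyMeasurable A (volume.restrict Q) ∧
    ∀ᵐ z ∂(volume.restrict Q), ‖matAct (A z)‖ ≤ Λ

/-- `f ∈ L^m(Q)` with `‖f‖_m ≤ Λ`. -/
def SourceBound {n : ℕ} (Λ m : ℝ) (Q : Set (ℝ × E n)) (f : ℝ × E n → ℝ) : Prop :=
  MemLp f (ENNReal.ofReal m) (volume.restrict Q) ∧
    eLpNorm f (ENNReal.ofReal m) (volume.restrict Q) ≤ ENNReal.ofReal Λ

/-- `u ∈ L^p(W^{1,p})` on `Q` and, in the sense of distributions on the interior of `Q`,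
`∂ₜu + Λ⁻¹ |∇u|^p - div (A ∇u) ≤ f`.
In the third term, `spaceDeriv φ z (A ∇u)` is `(A ∇u) · ∇φ`. -/
def SolvesInequality {n : ℕ} (Λ p : ℝ) (Q : Set (ℝ × E n))
    (A : ℝ × E n → Matrix (Fin n) (Fin n) ℝ) (f : ℝ × E n → ℝ)
    (u : ℝ × E n → ℝ) : Prop :=
  MemLp u (ENNReal.ofReal p) (volume.restrict Q) ∧
  ∃ Du : ℝ × E n → E n,
    IsWeakSpatialGradient Q u Du ∧
    MemLp Du (ENNReal.ofReal p) (volume.restrict Q) ∧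
    ∀ φ : ℝ × E n → ℝ, IsTestFunction Q φ → (∀ z, 0 ≤ φ z) →
      - (∫ z in Q, u z * timeDeriv φ z)
        + Λ⁻¹ * (∫ z in Q, ‖Du z‖ ^ p * φ z)
        + (∫ z in Q, spaceDeriv φ z (matAct (A z) (Du z)))
      ≤ ∫ z in Q, f z * φ z

end SuperquadraticHJ

end

noncomputable section

namespace SuperquadraticHJ

/-! The matrix `A` has no ellipticity, so the second-order term is an error and all coercivity comes
from the Hamiltonian. Testing a smooth subsolution `v` with `w ^ (k + 2)`, where `w = (v - c)₊`,
produces a diffusion error of size `|∇v|² w ^ (k + 1)`. Since `p > 2`, Young's inequality absorbs it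
into `|∇v|ᵖ w ^ (k + 2)` plus a constant on `{v > c}`, provided `k` is large (`exists_absorption`).
This gives `IsRegularSubsolution.energy`: both `∫ w ^ (k + 3)` at each time and `∬ |∇v|ᵖ w ^ (k +
2)` are bounded by a multiple of `U ^ (1 - 1 / m)`, where `U = |{v > c}| ≤ 1`.

On a slightly higher level, Chebyshev turns the first bound into smallness of each time slice of the
superlevel set and removes the weight from the second. The `L¹` Sobolev inequality on slices gains
the slice measure to the power `1 / N`, `N = max(n, 2)`, and Hölder bounds `∬ |∇v|`. Hence
(`exists_measureReal_superlevel_le`) the measure at level `c + d` is at most a power of `1 / d`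
times `U ^ (1 + σ)`, with `σ = (1 - 1 / m)(1 / N + 1 / p) - 1 / p`. The condition `m > 1 + N / p`
says exactly that `σ > 0`, and De Giorgi's iteration gives `v ≤ 1 / 5`.

The reduction to smooth `v` (`exists_isRegularSubsolution`) mollifies `u` and subtracts a growing
barrier, which replaces cutoff functions. The mollified flux is not controlled by the gradient of
the mollified `u`, but it is controlled by the mollification `h` of `|∇u|`. Jensen's inequality
keeps `hᵖ` on the left, so `h` stands in for the gradient throughout. The barrier is at most `3 /
10` on the inner cylinder, and `1 / 5 + 3 / 10 = 1 / 2`. -/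

/-! ### Powers of the positive part and absorption of the diffusion. -/

theorem hasDerivAt_max_zero_pow (k : ℕ) (y : ℝ) :
    HasDerivAt (fun y : ℝ => max y 0 ^ (k + 2)) ((k + 2 : ℝ) * max y 0 ^ (k + 1)) y := by
  rcases lt_trichotomy y 0 with hy | rfl | hy
  · rw [max_eq_right hy.le, zero_pow (by omega), mul_zero]
    refine (hasDerivAt_const y (0 : ℝ)).congr_of_eventuallyEq ?_
    filter_upwards [gt_mem_nhds hy] with x hx
    simp [max_eq_right (le_of_lt hx)]
  -- At the corner the truncated power is dominated in norm by `y ^ (k + 2)`, so it inherits the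
  -- zero derivative.
  · have h : HasDerivAt (fun y : ℝ => y ^ (k + 2)) 0 0 := by
      simpa using hasDerivAt_pow (k + 2) (0 : ℝ)
    rw [hasDerivAt_iff_isLittleO] at h ⊢
    simp only [max_self, ne_eq, Nat.add_eq_zero_iff, OfNat.ofNat_ne_zero, and_false,
      not_false_eq_true, zero_pow, sub_zero, one_ne_zero, mul_zero, smul_eq_mul] at h ⊢
    refine Asymptotics.IsBigO.trans_isLittleO (Asymptotics.IsBigO.of_bound 1 ?_) h
    refine Filter.Eventually.of_forall fun x => ?_
    rw [one_mul, norm_pow, norm_pow]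
    gcongr
    rw [Real.norm_eq_abs, Real.norm_eq_abs, abs_of_nonneg (le_max_right x 0)]
    exact max_le (le_abs_self x) (abs_nonneg x)
  · rw [max_eq_left hy.le]
    have h := hasDerivAt_pow (k + 2) y
    push_cast at h
    refine h.congr_of_eventuallyEq ?_
    filter_upwards [lt_mem_nhds hy] with x hx
    simp [max_eq_left (le_of_lt hx)]

/-- An exponent of at least two keeps truncations `C¹`, so the later integrations by parts are
classical. -/
theorem contDiff_max_zero_pow (k : ℕ) : ContDiff ℝ 1 (fun y : ℝ => max y 0 ^ (k + 2)) := by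
  rw [contDiff_one_iff_deriv]
  refine ⟨fun y => (hasDerivAt_max_zero_pow k y).differentiableAt, ?_⟩
  have : deriv (fun y : ℝ => max y 0 ^ (k + 2)) = fun y => (k + 2 : ℝ) * max y 0 ^ (k + 1) :=
    funext fun y => (hasDerivAt_max_zero_pow k y).deriv
  rw [this]
  fun_prop

/-- Absorption of the diffusion term by the superquadratic Hamiltonian. -/
theorem exists_absorption {p : ℝ} (hp : 2 < p) (k : ℕ) (hk : p / (p - 2) ≤ k + 2) {a l : ℝ}
    (ha : 0 < a) (hl : 0 < l) :
    ∃ C : ℝ, 0 < C ∧ ∀ h w : ℝ, 0 ≤ h → 0 < w → w ≤ 1 →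
      a * h ^ 2 * w ^ (k + 1) ≤ l * h ^ p * w ^ (k + 2) + C := by
  have hp2 : 0 < p - 2 := by linarith
  refine ⟨a * (a / l) ^ (2 / (p - 2)), by positivity, fun h w hh hw hw1 => ?_⟩
  rcases hh.eq_or_lt with rfl | hh
  · have : 0 ≤ l * (0:ℝ) ^ p * w ^ (k + 2) := by positivity
    have : 0 ≤ a * (a / l) ^ (2 / (p - 2)) := by positivity
    norm_num
    linarith
  -- In the first case the Hamiltonian term alone dominates. In the second, `h ^ 2` is bounded by
  -- the power `-2 / (p - 2)` of `w`, which `w ^ (k + 1)` compensates because `k + 1 ≥ 2 / (p - 2)`.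
  by_cases hc : a ≤ l * h ^ (p - 2) * w
  · have e : h ^ p = h ^ (p - 2) * h ^ 2 := by
      rw [← Real.rpow_natCast h 2, ← Real.rpow_add hh]; norm_num
    have : a * (h ^ 2 * w ^ (k + 1)) ≤ (l * h ^ (p - 2) * w) * (h ^ 2 * w ^ (k + 1)) := by gcongr
    have e2 : l * h ^ p * w ^ (k + 2) = (l * h ^ (p - 2) * w) * (h ^ 2 * w ^ (k + 1)) := by
      rw [e]; ring
    have : 0 ≤ a * (a / l) ^ (2 / (p - 2)) := by positivity
    linarith
  · push Not at hc
    have h1 : h ^ (p - 2) ≤ a / l / w := by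
      rw [le_div_iff₀ hw, le_div_iff₀ hl]; linarith
    have h2 : h ^ 2 ≤ (a / l) ^ (2 / (p - 2)) * w ^ (-(2 / (p - 2))) := by
      have : h ^ 2 = (h ^ (p - 2)) ^ (2 / (p - 2)) := by
        rw [← Real.rpow_mul hh.le, mul_div_cancel₀ _ hp2.ne']; norm_num
      rw [this, Real.rpow_neg hw.le, ← div_eq_mul_inv, ← Real.div_rpow (by positivity) hw.le]
      gcongr
    have h3 : w ^ (-(2 / (p - 2))) * w ^ (k + 1) ≤ 1 := by
      rw [← Real.rpow_natCast, ← Real.rpow_add hw]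
      refine Real.rpow_le_one hw.le hw1 ?_
      have : p / (p - 2) = 1 + 2 / (p - 2) := by field_simp; ring
      push_cast
      linarith
    have h4 : a * h ^ 2 * w ^ (k + 1) ≤ a * (a / l) ^ (2 / (p - 2)) := by
      calc a * h ^ 2 * w ^ (k + 1)
          ≤ a * ((a / l) ^ (2 / (p - 2)) * w ^ (-(2 / (p - 2)))) * w ^ (k + 1) := by gcongr
        _ = a * (a / l) ^ (2 / (p - 2)) * (w ^ (-(2 / (p - 2))) * w ^ (k + 1)) := by ring
        _ ≤ a * (a / l) ^ (2 / (p - 2)) * 1 := by gcongr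
        _ = _ := mul_one _
    have : 0 ≤ l * h ^ p * w ^ (k + 2) := by positivity
    linarith

/-! ### Hölder's inequality and the `L¹` Sobolev inequality. -/

/-- Hölder's inequality against the indicator of a set of finite measure. -/
theorem setIntegral_le_rpow_mul_rpow {α : Type*} [MeasurableSpace α] {μ : Measure α} {S : Set α}
    (hS : μ S ≠ ⊤) {f : α → ℝ} {p : ℝ} (hp : 1 < p) (hf0 : ∀ x, 0 ≤ f x)
    (hf : AEStronglyMeasurable f (μ.restrict S))
    (hfp : IntegrableOn (fun x => f x ^ p) S μ) :
    ∫ x in S, f x ∂μ ≤ (∫ x in S, f x ^ p ∂μ) ^ (1 / p) * μ.real S ^ (1 - 1 / p) := by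
  have hpq : p.HolderConjugate (p / (p - 1)) := Real.HolderConjugate.conjExponent hp
  have : IsFiniteMeasure (μ.restrict S) := ⟨by simpa using hS.lt_top⟩
  have hm : MemLp f (ENNReal.ofReal p) (μ.restrict S) := by
    rw [← integrable_norm_rpow_iff hf (by simp; linarith) (by simp),
      ENNReal.toReal_ofReal (by linarith)]
    refine hfp.congr (Filter.Eventually.of_forall fun x => ?_)
    simp [abs_of_nonneg (hf0 x)]
  have := integral_mul_le_Lp_mul_Lq_of_nonneg hpq (μ := μ.restrict S) (f := f) (g := fun _ => 1)
    (Filter.Eventually.of_forall hf0) (Filter.Eventually.of_forall fun _ => zero_le_one)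
    hm (memLp_const 1)
  have e : 1 / (p / (p - 1)) = 1 - 1 / p := by
    have : p ≠ 0 := by linarith
    have : p - 1 ≠ 0 := by linarith
    field_simp
  simpa [e] using this

/-- Gagliardo–Nirenberg–Sobolev bounds the `L^q` norm, `q = n / (n - 1)`, and Hölder on the support
contributes `1 - 1 / q = 1 / n`. The `+ 1` only makes the constant positive. -/
theorem integral_le_of_holderConjugate {n : ℕ} {q : NNReal}
    (hq : NNReal.HolderConjugate (Module.finrank ℝ (E n)) q)
    {w : E n → ℝ} (hw : ContDiff ℝ 1 w) (hc : HasCompactSupport w) (hw0 : ∀ x, 0 ≤ w x) :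
    ∫ x, w x ≤ (eLpNormLESNormFDerivOneConst (volume : Measure (E n)) q + 1) *
      volume.real (Function.support w) ^ (1 / (n : ℝ)) * ∫ x, ‖fderiv ℝ w x‖ := by
  set C := eLpNormLESNormFDerivOneConst (volume : Measure (E n)) q
  have hfin : volume (Function.support w) ≠ ⊤ :=
    ((measure_mono (subset_tsupport w)).trans_lt hc.isCompact.measure_lt_top).ne
  have h1 := eLpNorm_le_eLpNorm_fderiv_one (volume : Measure (E n)) hw hc hq
  have hq1 : (1 : ℝ≥0∞) ≤ q := by exact_mod_cast hq.symm.lt.le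
  have h2 := eLpNorm_le_eLpNorm_mul_rpow_measure_univ
    (μ := (volume : Measure (E n)).restrict (Function.support w)) hq1
    hw.continuous.aestronglyMeasurable.restrict
  rw [eLpNorm_restrict_eq_of_support_subset subset_rfl,
    eLpNorm_restrict_eq_of_support_subset subset_rfl, Measure.restrict_apply_univ] at h2
  have e : 1 / (1 : ℝ≥0∞).toReal - 1 / ((q : ℝ≥0∞)).toReal = 1 / (n : ℝ) := by
    have h := hq.inv_add_inv_eq_one
    have h' : (n : ℝ)⁻¹ + (q : ℝ)⁻¹ = 1 := by
      have := congrArg NNReal.toReal h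
      simpa using this
    simp only [ENNReal.toReal_one, ENNReal.coe_toReal, one_div, inv_one]
    linarith
  rw [e] at h2
  have hint : Integrable w := hw.continuous.integrable_of_hasCompactSupport hc
  have hint' : Integrable (fderiv ℝ w) :=
    (hw.continuous_fderiv one_ne_zero).integrable_of_hasCompactSupport (hc.fderiv ℝ)
  have h3 : ENNReal.ofReal (∫ x, w x) = eLpNorm w 1 volume := by
    rw [eLpNorm_one_eq_lintegral_enorm, ← ofReal_integral_norm_eq_lintegral_enorm hint]
    simp [abs_of_nonneg (hw0 _)]
  have h4 : ENNReal.ofReal (∫ x, ‖fderiv ℝ w x‖) = eLpNorm (fderiv ℝ w) 1 volume := by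
    rw [eLpNorm_one_eq_lintegral_enorm, ← ofReal_integral_norm_eq_lintegral_enorm hint']
  have hn0 : 0 ≤ 1 / (n : ℝ) := by positivity
  rw [← ENNReal.ofReal_le_ofReal_iff (by positivity), h3,
    ENNReal.ofReal_mul (by positivity), ENNReal.ofReal_mul (by positivity), h4,
    ← ENNReal.ofReal_rpow_of_nonneg (by positivity) hn0, measureReal_def,
    ENNReal.ofReal_toReal hfin]
  calc eLpNorm w 1 volume ≤ _ := h2
    _ ≤ (C * eLpNorm (fderiv ℝ w) 1 volume) * volume (Function.support w) ^ (1 / (n : ℝ)) := by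
        gcongr
    _ = C * volume (Function.support w) ^ (1 / (n : ℝ)) * eLpNorm (fderiv ℝ w) 1 volume := by
        ring
    _ ≤ _ := by
        gcongr
        rw [← ENNReal.ofReal_coe_nnreal]
        exact ENNReal.ofReal_le_ofReal (by simp)

/-- In dimension one, the fundamental theorem of calculus bounds `w` pointwise by the integral of
the norm of its derivative. -/
theorem integral_le_of_finrank_one {w : E 1 → ℝ} (hw : ContDiff ℝ 1 w) (hc : HasCompactSupport w) :
    ∫ x, w x ≤ volume.real (Function.support w) * ∫ x, ‖fderiv ℝ w x‖ := by
  have hfin : volume (Function.support w) ≠ ⊤ :=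
    ((measure_mono (subset_tsupport w)).trans_lt hc.isCompact.measure_lt_top).ne
  let L : ℝ → E 1 := fun r => EuclideanSpace.single 0 r
  have hLiso : Isometry L := by
    refine Isometry.of_dist_eq fun a b => ?_
    simp [L]
  have hL : MeasurePreserving L volume volume := by
    have h := ((EuclideanSpace.volume_preserving_symm_measurableEquiv_toLp (Fin 1)).symm).comp
      ((volume_preserving_funUnique (Fin 1) ℝ).symm)
    have e : L = (MeasurableEquiv.toLp 2 (Fin 1 → ℝ)).symm.symm ∘
        (MeasurableEquiv.funUnique (Fin 1) ℝ).symm := by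
      funext r
      refine PiLp.ext fun i => ?_
      fin_cases i
      rfl
    rwa [e]
  have hLe : MeasurableEmbedding L := hLiso.isClosedEmbedding.measurableEmbedding
  have key : ∀ x, w x ≤ ∫ y, ‖fderiv ℝ w y‖ := by
    intro x
    let g : ℝ → ℝ := fun r => w (x + L r)
    have hLs : L = fun r => r • L 1 := by
      funext r
      refine PiLp.ext fun i => ?_
      fin_cases i
      simp [L]
    have hLd : ∀ r, HasDerivAt (fun r => x + L r) (L 1) r := by
      intro r
      rw [hLs]
      simpa using ((hasDerivAt_id r).smul_const (L 1)).const_add x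
    have hLc : ContDiff ℝ 1 (fun r => x + L r) := by
      rw [hLs]
      fun_prop
    have hgc : ContDiff ℝ 1 g := hw.comp hLc
    have hgs : HasCompactSupport g :=
      hc.comp_isClosedEmbedding (((Homeomorph.addLeft x).isClosedEmbedding).comp
        hLiso.isClosedEmbedding)
    have h0 := hgs.integral_Iic_deriv_eq hgc 0
    have hgd : ∀ r, deriv g r = fderiv ℝ w (x + L r) (L 1) := fun r =>
      (((hw.differentiable one_ne_zero) (x + L r)).hasFDerivAt.comp_hasDerivAt r (hLd r)).deriv
    have hgi : Integrable (deriv g) :=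
      (hgc.continuous_deriv le_rfl).integrable_of_hasCompactSupport hgs.deriv
    calc w x = ∫ r in Iic 0, deriv g r := by
          rw [h0]
          have : L 0 = 0 := by simp [L]
          simp [g, this]
      _ ≤ ∫ r in Iic 0, ‖deriv g r‖ := integral_mono hgi.integrableOn hgi.norm.integrableOn
          fun r => le_abs_self _
      _ ≤ ∫ r, ‖deriv g r‖ := setIntegral_le_integral hgi.norm
          (Filter.Eventually.of_forall fun r => norm_nonneg _)
      _ ≤ ∫ r, ‖fderiv ℝ w (x + L r)‖ := by
          refine integral_mono hgi.norm ?_ fun r => ?_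
          · refine ((hw.continuous_fderiv one_ne_zero).comp
              hLc.continuous).norm.integrable_of_hasCompactSupport ?_
            exact ((hc.fderiv ℝ).comp_isClosedEmbedding
              (((Homeomorph.addLeft x).isClosedEmbedding).comp hLiso.isClosedEmbedding)).norm
          · simp only [hgd]
            refine (ContinuousLinearMap.le_opNorm _ _).trans ?_
            simp [L]
      _ = ∫ y, ‖fderiv ℝ w (x + y)‖ := hL.integral_comp hLe (fun y => ‖fderiv ℝ w (x + y)‖)
      _ = ∫ y, ‖fderiv ℝ w y‖ := integral_add_left_eq_self (fun y => ‖fderiv ℝ w y‖) x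
  calc ∫ x, w x = ∫ x in Function.support w, w x := (setIntegral_support).symm
    _ ≤ ∫ x in Function.support w, (∫ y, ‖fderiv ℝ w y‖) := by
        refine integral_mono (hw.continuous.integrable_of_hasCompactSupport hc).integrableOn
          (integrableOn_const hfin) key
    _ = _ := by simp

/-- The `L¹` Sobolev (isoperimetric) inequality, uniform over functions supported in a ball. -/
theorem exists_integral_le_measure_support_rpow (n : ℕ) (hn : 1 ≤ n) (R : ℝ) :
    ∃ C : ℝ, 0 < C ∧ ∀ w : E n → ℝ, ContDiff ℝ 1 w → (∀ x, 0 ≤ w x) →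
      (∀ x, R ≤ ‖x‖ → w x = 0) →
      ∫ x, w x ≤ C * volume.real (Function.support w) ^ (1 / max (n : ℝ) 2) *
        ∫ x, ‖fderiv ℝ w x‖ := by
  have hcs : ∀ w : E n → ℝ, (∀ x, R ≤ ‖x‖ → w x = 0) → HasCompactSupport w := fun w hw =>
    HasCompactSupport.intro (isCompact_closedBall (0 : E n) R) fun x hx => hw x (by
      simpa using le_of_lt (by simpa using hx))
  rcases hn.eq_or_lt with rfl | hn
  · refine ⟨volume.real (closedBall (0 : E 1) R) ^ (1 / 2 : ℝ) + 1, by positivity,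
      fun w hw _ hwR => (integral_le_of_finrank_one hw (hcs w hwR)).trans ?_⟩
    have hN : max ((1 : ℕ) : ℝ) 2 = 2 := by norm_num
    rw [hN]
    -- In dimension one the full power of the support measure is available. Confinement to a fixed
    -- ball lets half of that power be traded for a constant, giving the exponent `1 / 2`.
    have hle : volume.real (Function.support w) ≤ volume.real (closedBall (0 : E 1) R) := by
      refine measureReal_mono (fun x hx => ?_) measure_closedBall_lt_top.ne
      by_contra h
      exact hx (hwR x (le_of_lt (by simpa using h)))
    gcongr
    calc volume.real (Function.support w)
        = volume.real (Function.support w) ^ (1 / 2 : ℝ)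
          * volume.real (Function.support w) ^ (1 / 2 : ℝ) := by
          rw [← Real.sqrt_eq_rpow, Real.mul_self_sqrt measureReal_nonneg]
      _ ≤ volume.real (closedBall (0 : E 1) R) ^ (1 / 2 : ℝ)
          * volume.real (Function.support w) ^ (1 / 2 : ℝ) := by gcongr
      _ ≤ _ := by gcongr; linarith
  · have hn' : (1 : NNReal) < n := by exact_mod_cast hn
    have hq : NNReal.HolderConjugate (Module.finrank ℝ (E n)) (NNReal.conjExponent n) := by
      rw [finrank_euclideanSpace_fin]
      exact NNReal.HolderConjugate.conjExponent hn'
    refine ⟨eLpNormLESNormFDerivOneConst (volume : Measure (E n)) (NNReal.conjExponent n) + 1,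
      by positivity, fun w hw hw0 hwR => ?_⟩
    have hN : max (n : ℝ) 2 = n := max_eq_left (by exact_mod_cast hn)
    rw [hN]
    exact integral_le_of_holderConjugate hq hw (hcs w hwR) hw0

/-! ### Fast geometric convergence. -/

/-- Fast geometric convergence. -/
theorem tendsto_zero_of_le_mul_rpow {C B σ : ℝ} (hC : 0 < C) (hB : 1 < B) (hσ : 0 < σ) :
    ∃ δ : ℝ, 0 < δ ∧ ∀ U : ℕ → ℝ, (∀ k, 0 ≤ U k) → U 0 ≤ δ →
      (∀ k, U (k + 1) ≤ C * B ^ k * U k ^ (1 + σ)) →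
      Filter.Tendsto U Filter.atTop (nhds 0) := by
  have hB0 : 0 < B := by linarith
  -- The ansatz `U k ≤ δ * ρ ^ k` reproduces itself when `B * ρ ^ σ = 1` and `C * δ ^ σ = ρ`; these
  -- two equations determine `ρ` and `δ`.
  set ρ := B ^ (-(1 / σ)) with hρ
  have hρ0 : 0 < ρ := by positivity
  have hρ1 : ρ < 1 := Real.rpow_lt_one_of_one_lt_of_neg hB (by simpa using hσ)
  have hρσ : B * ρ ^ σ = 1 := by
    rw [hρ, ← Real.rpow_mul hB0.le]
    have : -(1 / σ) * σ = -1 := by field_simp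
    rw [this, Real.rpow_neg_one, mul_inv_cancel₀ hB0.ne']
  set δ := (ρ / C) ^ (1 / σ) with hδ
  have hδ0 : 0 < δ := by positivity
  have hδσ : C * δ ^ σ = ρ := by
    rw [hδ, ← Real.rpow_mul (by positivity), one_div_mul_cancel hσ.ne', Real.rpow_one]
    field_simp
  refine ⟨δ, hδ0, fun U hU h0 hs => ?_⟩
  have hb : ∀ k, U k ≤ δ * ρ ^ k := by
    intro k
    induction k with
    | zero => simpa using h0
    | succ k ih =>
      have e1 : (δ * ρ ^ k) ^ (1 + σ) = δ * ρ ^ k * (δ ^ σ * (ρ ^ σ) ^ k) := by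
        rw [Real.rpow_add (by positivity), Real.rpow_one, Real.mul_rpow hδ0.le (by positivity),
          ← Real.rpow_natCast ρ k, ← Real.rpow_natCast (ρ ^ σ) k, ← Real.rpow_mul hρ0.le,
          ← Real.rpow_mul hρ0.le, mul_comm σ]
      calc U (k + 1) ≤ C * B ^ k * U k ^ (1 + σ) := hs k
        _ ≤ C * B ^ k * (δ * ρ ^ k) ^ (1 + σ) := by
          have := hU k
          gcongr
        _ = δ * ρ ^ k * (C * δ ^ σ) * (B * ρ ^ σ) ^ k := by rw [e1, mul_pow]; ring
        _ = δ * ρ ^ (k + 1) := by rw [hδσ, hρσ]; ring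
  refine squeeze_zero hU hb ?_
  simpa using (tendsto_pow_atTop_nhds_zero_of_lt_one hρ0.le hρ1).const_mul δ

/-! ### Slicing and integration by parts up to a given time. -/

instance isAddHaarMeasure_volume_prod (n : ℕ) :
    (volume : Measure (ℝ × E n)).IsAddHaarMeasure :=
  inferInstanceAs ((volume : Measure ℝ).prod (volume : Measure (E n))).IsAddHaarMeasure

variable {n : ℕ}

theorem hasFDerivAt_slice {φ : ℝ × E n → ℝ} (hφ : Differentiable ℝ φ) (t : ℝ) (x : E n) :
    HasFDerivAt (fun y => φ (t, y))
      ((fderiv ℝ φ (t, x)).comp (ContinuousLinearMap.inr ℝ ℝ (E n))) x :=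
  (hφ (t, x)).hasFDerivAt.comp x (hasFDerivAt_prodMk_right t x)

theorem spaceDeriv_eq_fderiv_slice {φ : ℝ × E n → ℝ} (hφ : Differentiable ℝ φ) (t : ℝ) (x e : E n) :
    spaceDeriv φ (t, x) e = fderiv ℝ (fun y => φ (t, y)) x e := by
  rw [(hasFDerivAt_slice hφ t x).fderiv]
  simp [spaceDeriv]

theorem timeDeriv_eq_deriv_slice {φ : ℝ × E n → ℝ} (hφ : Differentiable ℝ φ) (t : ℝ) (x : E n) :
    timeDeriv φ (t, x) = deriv (fun s => φ (s, x)) t := by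
  have h : HasDerivAt (fun s : ℝ => (s, x)) ((1 : ℝ), (0 : E n)) t :=
    (hasDerivAt_id t).prodMk (hasDerivAt_const t x)
  exact ((hφ (t, x)).hasFDerivAt.comp_hasDerivAt t h).deriv.symm

theorem isClosedEmbedding_prodMk_left (t : ℝ) :
    Topology.IsClosedEmbedding (fun x : E n => (t, x)) :=
  Isometry.isClosedEmbedding (Isometry.of_dist_eq fun a b => by simp [Prod.dist_eq])

theorem isClosedEmbedding_prodMk_right (x : E n) :
    Topology.IsClosedEmbedding (fun t : ℝ => (t, x)) :=
  Isometry.isClosedEmbedding (Isometry.of_dist_eq fun a b => by simp [Prod.dist_eq])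

theorem continuous_spaceDeriv {φ : ℝ × E n → ℝ} (hφ : ContDiff ℝ 1 φ) {e : ℝ × E n → E n}
    (he : Continuous e) : Continuous fun z => spaceDeriv φ z (e z) := by
  have := hφ.continuous_fderiv one_ne_zero
  unfold spaceDeriv
  fun_prop

theorem continuous_timeDeriv {φ : ℝ × E n → ℝ} (hφ : ContDiff ℝ 1 φ) :
    Continuous fun z => timeDeriv φ z := by
  have := hφ.continuous_fderiv one_ne_zero
  unfold timeDeriv
  fun_prop

/-- The boundary term at the cut `t₀` is what yields energy bounds on every time slice. -/
theorem setIntegral_timeDeriv {φ : ℝ × E n → ℝ} (hφ : ContDiff ℝ 1 φ) (hc : HasCompactSupport φ)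
    (t₀ : ℝ) : ∫ z in Iic t₀ ×ˢ univ, timeDeriv φ z = ∫ x, φ (t₀, x) := by
  have hcs : HasCompactSupport fun z => timeDeriv φ z :=
    (hc.fderiv ℝ).comp_left (g := fun L : ℝ × E n →L[ℝ] ℝ => L (1, 0)) (by simp)
  have hi := (continuous_timeDeriv hφ).integrable_of_hasCompactSupport hcs (μ := volume)
  rw [Measure.volume_eq_prod, ← Measure.restrict_univ (μ := (volume : Measure (E n)))] at *
  rw [← Measure.prod_restrict, Measure.restrict_univ, Measure.restrict_univ] at *
  have hi' : Integrable (fun z => timeDeriv φ z)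
      (((volume : Measure ℝ).restrict (Iic t₀)).prod (volume : Measure (E n))) := by
    refine hi.mono_measure ?_
    exact Measure.prod_mono Measure.restrict_le_self le_rfl
  rw [integral_prod_symm _ hi']
  refine integral_congr_ae (Filter.Eventually.of_forall fun x => ?_)
  simp only [timeDeriv_eq_deriv_slice (hφ.differentiable one_ne_zero)]
  exact (hc.comp_isClosedEmbedding (isClosedEmbedding_prodMk_right x)).integral_Iic_deriv_eq
    (hφ.comp (by fun_prop)) t₀

/-- Spatial integration by parts takes place within each slice, so cutting off time creates no
boundary term. -/
theorem setIntegral_spaceDeriv_mul {g φ : ℝ × E n → ℝ} (hg : ContDiff ℝ 1 g) (hφ : ContDiff ℝ 1 φ)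
    (hc : HasCompactSupport φ) (t₀ : ℝ) (e : E n) :
    ∫ z in Iic t₀ ×ˢ univ, spaceDeriv g z e * φ z =
      - ∫ z in Iic t₀ ×ˢ univ, g z * spaceDeriv φ z e := by
  have hcs : HasCompactSupport fun z => spaceDeriv φ z e :=
    (hc.fderiv ℝ).comp_left (g := fun L : ℝ × E n →L[ℝ] ℝ => L (0, e)) (by simp)
  have hi1 : Integrable (fun z => spaceDeriv g z e * φ z) volume :=
    ((continuous_spaceDeriv hg continuous_const).mul hφ.continuous).integrable_of_hasCompactSupport
      hc.mul_left
  have hi2 : Integrable (fun z => g z * spaceDeriv φ z e) volume :=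
    (hg.continuous.mul (continuous_spaceDeriv hφ continuous_const)).integrable_of_hasCompactSupport
      hcs.mul_left
  have gd := hg.differentiable one_ne_zero
  have φd := hφ.differentiable one_ne_zero
  rw [Measure.volume_eq_prod] at *
  rw [setIntegral_prod _ hi1.integrableOn, setIntegral_prod _ hi2.integrableOn, ← integral_neg]
  refine integral_congr_ae (Filter.Eventually.of_forall fun t => ?_)
  simp only [Measure.restrict_univ, spaceDeriv_eq_fderiv_slice gd, spaceDeriv_eq_fderiv_slice φd]
  have gs : ContDiff ℝ 1 fun y => g (t, y) := hg.comp (by fun_prop)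
  have φs : ContDiff ℝ 1 fun y => φ (t, y) := hφ.comp (by fun_prop)
  have cs : HasCompactSupport fun y => φ (t, y) :=
    hc.comp_isClosedEmbedding (isClosedEmbedding_prodMk_left t)
  have c1 : Continuous fun y => fderiv ℝ (fun y => g (t, y)) y e :=
    (gs.continuous_fderiv one_ne_zero).clm_apply continuous_const
  have c2 : Continuous fun y => fderiv ℝ (fun y => φ (t, y)) y e :=
    (φs.continuous_fderiv one_ne_zero).clm_apply continuous_const
  have cs2 : HasCompactSupport fun y => fderiv ℝ (fun y => φ (t, y)) y e :=
    (cs.fderiv ℝ).comp_left (g := fun L : E n →L[ℝ] ℝ => L e) (by simp)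
  rw [integral_mul_fderiv_eq_neg_fderiv_mul_of_integrable, neg_neg]
  · exact (c1.mul φs.continuous).integrable_of_hasCompactSupport cs.mul_left
  · exact (gs.continuous.mul c2).integrable_of_hasCompactSupport cs2.mul_left
  · exact (gs.continuous.mul φs.continuous).integrable_of_hasCompactSupport cs.mul_left
  · exact fun x _ => gs.differentiable one_ne_zero x
  · exact fun x _ => φs.differentiable one_ne_zero x

theorem spaceDeriv_eq_sum (φ : ℝ × E n → ℝ) (z : ℝ × E n) (e : E n) :
    spaceDeriv φ z e = ∑ i, e i * spaceDeriv φ z (EuclideanSpace.single i 1) := by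
  have h : ((0 : ℝ), e) = ∑ i, e i • ((0 : ℝ), (EuclideanSpace.single i (1:ℝ) : E n)) := by
    have := (EuclideanSpace.basisFun (Fin n) ℝ).sum_repr e
    simp only [EuclideanSpace.basisFun_repr, EuclideanSpace.basisFun_apply] at this
    refine Prod.ext (by simp [Prod.fst_sum]) ?_
    rw [Prod.snd_sum]
    simpa using this.symm
  rw [spaceDeriv, h, map_sum]
  exact Finset.sum_congr rfl fun i _ => map_smul _ _ _

/-- The spatial divergence of a vector field. -/
def spaceDiv (G : ℝ × E n → E n) (z : ℝ × E n) : ℝ :=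
  ∑ i, spaceDeriv (fun z => G z i) z (EuclideanSpace.single i 1)

theorem setIntegral_spaceDiv_mul {G : ℝ × E n → E n} {φ : ℝ × E n → ℝ} (hG : ContDiff ℝ 1 G)
    (hφ : ContDiff ℝ 1 φ) (hc : HasCompactSupport φ) (t₀ : ℝ) :
    ∫ z in Iic t₀ ×ˢ univ, spaceDiv G z * φ z =
      ∫ z in Iic t₀ ×ˢ univ, - spaceDeriv φ z (G z) := by
  have hGi : ∀ i, ContDiff ℝ 1 fun z => G z i := contDiff_euclidean.1 hG
  have h1 : ∀ z, spaceDeriv φ z (G z) = ∑ i, G z i * spaceDeriv φ z (EuclideanSpace.single i 1) :=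
    fun z => spaceDeriv_eq_sum φ z (G z)
  simp only [spaceDiv, Finset.sum_mul, h1, integral_neg]
  rw [integral_finsetSum, integral_finsetSum, ← Finset.sum_neg_distrib]
  · exact Finset.sum_congr rfl fun i _ => setIntegral_spaceDeriv_mul (hGi i) hφ hc t₀ _
  · intro i _
    have hcs : HasCompactSupport fun z => spaceDeriv φ z (EuclideanSpace.single i 1) :=
      (hc.fderiv ℝ).comp_left (g := fun L : ℝ × E n →L[ℝ] ℝ => L (0, EuclideanSpace.single i 1))
        (by simp)
    exact (((hGi i).continuous.mul
      (continuous_spaceDeriv hφ continuous_const)).integrable_of_hasCompactSupport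
        hcs.mul_left).integrableOn
  · intro i _
    exact (((continuous_spaceDeriv (hGi i) continuous_const).mul
      hφ.continuous).integrable_of_hasCompactSupport hc.mul_left).integrableOn

/-! ### Regular subsolutions and their energy inequality. -/

/-- A `C¹` function `v ≤ 1`, nonpositive away from a fixed box, satisfying on `{v > 0}` up to time
`T` the inequality `∂ₜv + l hᵖ ≤ div G + F`, where `h` dominates `|∇v|` and `|G| ≤ K h`. -/
structure IsRegularSubsolution (T l K p m : ℝ) (v h F : ℝ × E n → ℝ) (G : ℝ × E n → E n) :
    Prop where
  contDiff : ContDiff ℝ 1 v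
  contDiff_flux : ContDiff ℝ 1 G
  continuous_grad : Continuous h
  continuous_source : Continuous F
  grad_nonneg : ∀ z, 0 ≤ h z
  source_nonneg : ∀ z, 0 ≤ F z
  le_one : ∀ z, v z ≤ 1
  nonpos_of_time : ∀ z, 3 / 2 ≤ |z.1| → v z ≤ 0
  nonpos_of_space : ∀ z, 3 / 2 ≤ ‖z.2‖ → v z ≤ 0
  inequality : ∀ z, z.1 ≤ T → 0 < v z → timeDeriv v z + l * h z ^ p ≤ spaceDiv G z + F z
  spaceDeriv_le : ∀ z, z.1 ≤ T → 0 < v z → ∀ e, |spaceDeriv v z e| ≤ h z * ‖e‖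
  flux_le : ∀ z, z.1 ≤ T → 0 < v z → ‖G z‖ ≤ K * h z
  source_le : ∀ S : Set (ℝ × E n), MeasurableSet S → S ⊆ {z | z.1 ≤ T ∧ 0 < v z} →
    ∫ z in S, F z ≤ K * volume.real S ^ (1 - 1 / m)

/-- The points before time `T` where `v > c`. -/
def superlevel (T : ℝ) (v : ℝ × E n → ℝ) (c : ℝ) : Set (ℝ × E n) := {z | z.1 ≤ T ∧ c < v z}

theorem measurableSet_superlevel {v : ℝ × E n → ℝ} (hv : Continuous v) (T c : ℝ) :
    MeasurableSet (superlevel T v c) :=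
  (measurableSet_le measurable_fst measurable_const).inter
    (measurableSet_lt measurable_const hv.measurable)

theorem superlevel_anti (T : ℝ) (v : ℝ × E n → ℝ) {c c' : ℝ} (h : c ≤ c') :
    superlevel T v c' ⊆ superlevel T v c := fun _ hz => ⟨hz.1, h.trans_lt hz.2⟩

section truncation

variable {v : ℝ × E n → ℝ} {c : ℝ}

theorem contDiff_truncation (hv : ContDiff ℝ 1 v) (c : ℝ) (k : ℕ) :
    ContDiff ℝ 1 fun z => max (v z - c) 0 ^ (k + 2) :=
  (contDiff_max_zero_pow k).comp (hv.sub contDiff_const)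

theorem fderiv_truncation (hv : ContDiff ℝ 1 v) (c : ℝ) (k : ℕ) (z : ℝ × E n) :
    fderiv ℝ (fun z => max (v z - c) 0 ^ (k + 2)) z =
      ((k + 2 : ℝ) * max (v z - c) 0 ^ (k + 1)) • fderiv ℝ v z := by
  have h := ((hv.differentiable one_ne_zero) z).hasFDerivAt.sub_const c
  exact HasFDerivAt.fderiv (HasDerivAt.comp_hasFDerivAt (f := fun z => v z - c) z
    (hasDerivAt_max_zero_pow k (v z - c)) h)

end truncation

namespace IsRegularSubsolution

variable {T l K p m : ℝ} {v h F : ℝ × E n → ℝ} {G : ℝ × E n → E n}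

theorem mem_box (H : IsRegularSubsolution T l K p m v h F G) {z : ℝ × E n} (hz : 0 < v z) :
    z ∈ Icc (-(3 / 2) : ℝ) (3 / 2) ×ˢ closedBall (0 : E n) (3 / 2) := by
  refine ⟨abs_le.1 ?_, ?_⟩
  · by_contra! h
    exact absurd (H.nonpos_of_time z h.le) (not_le.2 hz)
  · rw [mem_closedBall_zero_iff]
    by_contra! h
    exact absurd (H.nonpos_of_space z h.le) (not_le.2 hz)

theorem isCompact_box : IsCompact (Icc (-(3 / 2) : ℝ) (3 / 2) ×ˢ closedBall (0 : E n) (3 / 2)) :=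
  isCompact_Icc.prod (isCompact_closedBall _ _)

theorem hasCompactSupport_truncation (H : IsRegularSubsolution T l K p m v h F G) {c : ℝ}
    (hc : 0 ≤ c) (k : ℕ) : HasCompactSupport fun z => max (v z - c) 0 ^ (k + 1) := by
  refine HasCompactSupport.intro isCompact_box fun z hz => ?_
  have : v z ≤ 0 := by
    by_contra! h
    exact hz (H.mem_box h)
  rw [max_eq_right (by linarith), zero_pow (by omega)]

theorem measure_superlevel_ne_top (H : IsRegularSubsolution T l K p m v h F G) {c : ℝ}
    (hc : 0 ≤ c) : volume (superlevel T v c) ≠ ⊤ :=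
  ((measure_mono fun _ hz => H.mem_box (hc.trans_lt hz.2)).trans_lt
    isCompact_box.measure_lt_top).ne

/-- The energy inequality. -/
theorem energy (H : IsRegularSubsolution T l K p m v h F G) (hp : 2 < p) {k : ℕ} {C : ℝ} (hC0 : 0 < C)
    (hC : ∀ h w : ℝ, 0 ≤ h → 0 < w → w ≤ 1 →
      ((k + 2) * K) * h ^ 2 * w ^ (k + 1) ≤ (l / 2) * h ^ p * w ^ (k + 2) + C)
    {c t₀ : ℝ} (hc : 0 ≤ c) (ht : t₀ ≤ T) :
    (k + 3 : ℝ)⁻¹ * (∫ x, max (v (t₀, x) - c) 0 ^ (k + 3)) +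
      (l / 2) * ∫ z in Iic t₀ ×ˢ univ, h z ^ p * max (v z - c) 0 ^ (k + 2) ≤
    C * volume.real (superlevel T v c) + K * volume.real (superlevel T v c) ^ (1 - 1 / m) := by
  set W : ℝ × E n → ℝ := fun z => max (v z - c) 0 ^ (k + 2) with hW
  have hWc : ContDiff ℝ 1 W := contDiff_truncation H.contDiff c k
  have hWs : HasCompactSupport W := H.hasCompactSupport_truncation hc (k + 1)
  have hW0 : ∀ z, 0 ≤ W z := fun z => by positivity
  have hw1 : ∀ z, max (v z - c) 0 ≤ 1 := fun z =>
    max_le (by linarith [H.le_one z]) zero_le_one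
  have hW1 : ∀ z, W z ≤ 1 := fun z => pow_le_one₀ (le_max_right _ _) (hw1 z)
  have hWz : ∀ z, v z ≤ c → max (v z - c) 0 = 0 := fun z hz => max_eq_right (by linarith)
  set Q : Set (ℝ × E n) := Iic t₀ ×ˢ univ with hQ
  have hQm : MeasurableSet Q := measurableSet_Iic.prod MeasurableSet.univ
  set S := superlevel T v c with hS
  have hSm : MeasurableSet S := measurableSet_superlevel H.contDiff.continuous T c
  have hSfin : volume S ≠ ⊤ := H.measure_superlevel_ne_top hc
  have hhp : Continuous fun z => h z ^ p :=
    H.continuous_grad.rpow_const fun _ => Or.inr (by linarith)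
  -- The integrand is the time derivative of `w ^ (k + 3) / (k + 3)`, with `w` the truncation. Only
  -- the term at `t₀` survives, since truncations have compact support.
  have htime : ∫ z in Q, timeDeriv v z * W z =
      (k + 3 : ℝ)⁻¹ * ∫ x, max (v (t₀, x) - c) 0 ^ (k + 3) := by
    rw [← setIntegral_timeDeriv (contDiff_truncation H.contDiff c (k + 1))
      (H.hasCompactSupport_truncation hc (k + 2)) t₀, ← integral_const_mul]
    refine integral_congr_ae (Filter.Eventually.of_forall fun z => ?_)
    simp only [timeDeriv, fderiv_truncation H.contDiff c (k + 1) z]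
    have : (k + 3 : ℝ) ≠ 0 := by positivity
    simp only [smul_apply, smul_eq_mul, hW]
    push_cast
    field_simp
    ring
  have hi1 : Integrable (fun z => timeDeriv v z * W z) (volume.restrict Q) :=
    (((continuous_timeDeriv H.contDiff).mul hWc.continuous).integrable_of_hasCompactSupport
      hWs.mul_left).integrableOn
  have hi2 : Integrable (fun z => h z ^ p * W z) (volume.restrict Q) :=
    ((hhp.mul hWc.continuous).integrable_of_hasCompactSupport hWs.mul_left).integrableOn
  have hdivc : Continuous (spaceDiv G) := by
    refine continuous_finsetSum _ fun i _ => ?_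
    exact continuous_spaceDeriv (contDiff_euclidean.1 H.contDiff_flux i) continuous_const
  have hi3 : Integrable (fun z => spaceDiv G z * W z) (volume.restrict Q) :=
    ((hdivc.mul hWc.continuous).integrable_of_hasCompactSupport hWs.mul_left).integrableOn
  have hi4 : Integrable (fun z => F z * W z) (volume.restrict Q) :=
    ((H.continuous_source.mul hWc.continuous).integrable_of_hasCompactSupport
      hWs.mul_left).integrableOn
  have hi5 : Integrable (fun z => -spaceDeriv W z (G z)) (volume.restrict Q) := by
    refine ((continuous_spaceDeriv hWc
      H.contDiff_flux.continuous).neg.integrable_of_hasCompactSupport ?_).integrableOn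
    refine (hWs.fderiv ℝ).mono fun z hz => ?_
    contrapose! hz
    simp only [Function.mem_support, ne_eq, not_not] at hz ⊢
    simp [spaceDeriv, hz]
  have hi6 : Integrable (fun z => S.indicator (fun _ => C) z) (volume.restrict Q) :=
    ((integrable_indicator_iff hSm).2 (integrableOn_const hSfin)).integrableOn
  have hi7 : Integrable (fun z => S.indicator F z) (volume : Measure (ℝ × E n)) := by
    rw [integrable_indicator_iff hSm]
    exact (H.continuous_source.continuousOn.integrableOn_compact isCompact_box).mono_set
      fun z hz => H.mem_box (hc.trans_lt hz.2)
  -- The differential inequality is known only where `v` is positive, which suffices because `W`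
  -- vanishes off `{v > c}`.
  have hmain : ∫ z in Q, (timeDeriv v z * W z + l * (h z ^ p * W z)) ≤
      ∫ z in Q, (spaceDiv G z * W z + F z * W z) := by
    refine setIntegral_mono_on (hi1.add (hi2.const_mul l)) (hi3.add hi4) hQm fun z hz => ?_
    rcases le_or_gt (v z) c with hvc | hvc
    · simp [hW, hWz z hvc]
    · have := mul_le_mul_of_nonneg_right
        (H.inequality z ((show z.1 ≤ t₀ from hz.1).trans ht) (hc.trans_lt hvc)) (hW0 z)
      linarith
  -- Absorption spends half of the Hamiltonian here and costs the constant `C` on the superlevel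
  -- set.
  have hdiff : ∫ z in Q, -spaceDeriv W z (G z) ≤
      ∫ z in Q, ((l / 2) * (h z ^ p * W z) + S.indicator (fun _ => C) z) := by
    refine setIntegral_mono_on hi5 ((hi2.const_mul _).add hi6) hQm fun z hz => ?_
    have hzT : z.1 ≤ T := (show z.1 ≤ t₀ from hz.1).trans ht
    simp only [spaceDeriv, hW, fderiv_truncation H.contDiff c k z]
    rcases le_or_gt (v z) c with hvc | hvc
    · simp only [hWz z hvc]
      simp
      exact indicator_nonneg (fun _ _ => hC0.le) _
    · have hzS : z ∈ S := ⟨hzT, hvc⟩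
      have hv0 : 0 < v z := hc.trans_lt hvc
      rw [indicator_of_mem hzS]
      have hw0 : 0 < max (v z - c) 0 := lt_max_of_lt_left (by linarith)
      have key := hC (h z) _ (H.grad_nonneg z) hw0 (hw1 z)
      have hg : |spaceDeriv v z (G z)| ≤ K * h z ^ 2 := by
        refine (H.spaceDeriv_le z hzT hv0 (G z)).trans ?_
        calc h z * ‖G z‖ ≤ h z * (K * h z) :=
              mul_le_mul_of_nonneg_left (H.flux_le z hzT hv0) (H.grad_nonneg z)
          _ = K * h z ^ 2 := by ring
      have hg' := (neg_le_abs _).trans hg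
      simp only [smul_apply, smul_eq_mul]
      simp only [spaceDeriv] at hg'
      have hpos : 0 ≤ (k + 2 : ℝ) * max (v z - c) 0 ^ (k + 1) := by positivity
      have := mul_le_mul_of_nonneg_left hg' hpos
      linarith
  have hsrc : ∫ z in Q, F z * W z ≤ K * volume.real S ^ (1 - 1 / m) := by
    have hSs : S ⊆ {z | z.1 ≤ T ∧ 0 < v z} := fun z hz => ⟨hz.1, hc.trans_lt hz.2⟩
    calc ∫ z in Q, F z * W z ≤ ∫ z in Q, S.indicator F z := by
          refine setIntegral_mono_on hi4 hi7.integrableOn hQm fun z hz => ?_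
          rcases le_or_gt (v z) c with hvc | hvc
          · simp only [hW, hWz z hvc]
            simp only [ne_eq, Nat.add_eq_zero_iff, OfNat.ofNat_ne_zero, and_false,
              not_false_eq_true, zero_pow, mul_zero]
            exact indicator_nonneg (fun z _ => H.source_nonneg z) _
          · have hzS : z ∈ S := ⟨(show z.1 ≤ t₀ from hz.1).trans ht, hvc⟩
            rw [indicator_of_mem hzS]
            exact mul_le_of_le_one_right (H.source_nonneg z) (hW1 z)
      _ ≤ ∫ z, S.indicator F z := setIntegral_le_integral hi7
          (Filter.Eventually.of_forall (indicator_nonneg fun z _ => H.source_nonneg z))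
      _ = ∫ z in S, F z := integral_indicator hSm
      _ ≤ _ := H.source_le S hSm hSs
  have hind : ∫ z in Q, S.indicator (fun _ => C) z ≤ C * volume.real S := by
    calc ∫ z in Q, S.indicator (fun _ => C) z ≤ ∫ z, S.indicator (fun _ => C) z :=
          setIntegral_le_integral ((integrable_indicator_iff hSm).2 (integrableOn_const hSfin))
            (Filter.Eventually.of_forall (indicator_nonneg fun _ _ => hC0.le))
      _ = C * volume.real S := by
          rw [integral_indicator hSm]
          simp [mul_comm]
  rw [integral_add hi1 (hi2.const_mul l), integral_add hi3 hi4, integral_const_mul,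
    setIntegral_spaceDiv_mul H.contDiff_flux hWc hWs, htime] at hmain
  rw [integral_add (hi2.const_mul _) hi6, integral_const_mul] at hdiff
  linarith

end IsRegularSubsolution

/-! ### From energy to superlevel sets. -/

namespace IsRegularSubsolution

variable {T l K p m : ℝ} {v h F : ℝ × E n → ℝ} {G : ℝ × E n → E n}

/-- Chebyshev's inequality: the truncation at `c` exceeds `d` wherever `v > c + d`. -/
theorem measureReal_slice_le (H : IsRegularSubsolution T l K p m v h F G) {c d : ℝ} (hc : 0 ≤ c)
    (hd : 0 < d) (k : ℕ) (t : ℝ) :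
    d ^ (k + 1) * volume.real {x | c + d < v (t, x)} ≤ ∫ x, max (v (t, x) - c) 0 ^ (k + 1) := by
  have hv := H.contDiff.continuous
  have hi : Integrable fun x => max (v (t, x) - c) 0 ^ (k + 1) :=
    Continuous.integrable_of_hasCompactSupport (by fun_prop)
      ((H.hasCompactSupport_truncation hc k).comp_isClosedEmbedding
        (isClosedEmbedding_prodMk_left t))
  refine le_trans ?_ (mul_meas_ge_le_integral_of_nonneg
    (Filter.Eventually.of_forall fun x => by positivity) hi (d ^ (k + 1)))
  refine mul_le_mul_of_nonneg_left (measureReal_mono (fun x hx => ?_) ?_) (by positivity)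
  · have hx : c + d < v (t, x) := hx
    exact pow_le_pow_left₀ hd.le (le_max_of_le_left (by linarith)) _
  · exact (hi.measure_ge_lt_top (by positivity)).ne

theorem measureReal_superlevel_le (H : IsRegularSubsolution T l K p m v h F G) {c d : ℝ}
    (hc : 0 ≤ c) (hd : 0 < d) (k : ℕ) :
    d ^ (k + 1) * volume.real (superlevel T v (c + d)) ≤
      ∫ z in Iic T ×ˢ univ, max (v z - c) 0 ^ (k + 1) := by
  have hv := H.contDiff.continuous
  have hi : Integrable (fun z => max (v z - c) 0 ^ (k + 1)) (volume.restrict (Iic T ×ˢ univ)) :=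
    (Continuous.integrable_of_hasCompactSupport (by fun_prop)
      (H.hasCompactSupport_truncation hc k)).integrableOn
  refine le_trans ?_ (mul_meas_ge_le_integral_of_nonneg
    (Filter.Eventually.of_forall fun x => by positivity) hi (d ^ (k + 1)))
  refine mul_le_mul_of_nonneg_left ?_ (by positivity)
  have hsub : superlevel T v (c + d) ⊆ Iic T ×ˢ univ := fun z hz => ⟨hz.1, mem_univ _⟩
  rw [← inter_eq_left.2 hsub,
    ← measureReal_restrict_apply (measurableSet_superlevel hv T (c + d))]
  refine measureReal_mono (fun z hz => ?_) (hi.measure_ge_lt_top (by positivity)).ne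
  exact pow_le_pow_left₀ hd.le (le_max_of_le_left (by linarith [hz.2])) _

/-- The weight in the energy degenerates at level `c`; raising the level by `d` bounds it below by
`d ^ (k + 1)`. -/
theorem setIntegral_grad_rpow_le (H : IsRegularSubsolution T l K p m v h F G) (hp : 2 < p)
    {c d : ℝ} (hc : 0 ≤ c) (hd : 0 < d) (k : ℕ) :
    d ^ (k + 1) * ∫ z in superlevel T v (c + d), h z ^ p ≤
      ∫ z in Iic T ×ˢ univ, h z ^ p * max (v z - c) 0 ^ (k + 1) := by
  have hv := H.contDiff.continuous
  have hhp : Continuous fun z => h z ^ p :=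
    H.continuous_grad.rpow_const fun _ => Or.inr (by linarith)
  have hi : Integrable fun z => h z ^ p * max (v z - c) 0 ^ (k + 1) :=
    Continuous.integrable_of_hasCompactSupport (by fun_prop)
      (H.hasCompactSupport_truncation hc k).mul_left
  have hSm := measurableSet_superlevel hv T (c + d)
  have hi2 : IntegrableOn (fun z => h z ^ p) (superlevel T v (c + d)) :=
    (hhp.continuousOn.integrableOn_compact isCompact_box).mono_set
      fun z hz => H.mem_box (by linarith [hz.2])
  have hh0 : ∀ z, 0 ≤ h z ^ p := fun z => Real.rpow_nonneg (H.grad_nonneg z) p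
  calc d ^ (k + 1) * ∫ z in superlevel T v (c + d), h z ^ p
      = ∫ z in superlevel T v (c + d), h z ^ p * d ^ (k + 1) := by
        rw [integral_mul_const, mul_comm]
    _ ≤ ∫ z in superlevel T v (c + d), h z ^ p * max (v z - c) 0 ^ (k + 1) := by
        refine setIntegral_mono_on (hi2.mul_const _) hi.integrableOn hSm fun z hz => ?_
        have : d ≤ max (v z - c) 0 := le_max_of_le_left (by linarith [hz.2])
        have := hh0 z
        gcongr
    _ ≤ _ := setIntegral_mono_set hi.integrableOn
        (Filter.Eventually.of_forall fun z => mul_nonneg (hh0 z) (by positivity))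
        (Filter.Eventually.of_forall fun z hz => ⟨hz.1, mem_univ _⟩)

/-- Sobolev's inequality on time slices, integrated in time. -/
theorem setIntegral_truncation_sq_le (H : IsRegularSubsolution T l K p m v h F G) {A M N : ℝ}
    (hA : 0 ≤ A) (hN : 0 ≤ N)
    (hS : ∀ w : E n → ℝ, ContDiff ℝ 1 w → (∀ x, 0 ≤ w x) → (∀ x, 3 / 2 ≤ ‖x‖ → w x = 0) →
      ∫ x, w x ≤ A * volume.real (Function.support w) ^ N * ∫ x, ‖fderiv ℝ w x‖)
    {c : ℝ} (hc : 0 ≤ c) (hM : ∀ t ≤ T, volume.real {x | c < v (t, x)} ≤ M) :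
    ∫ z in Iic T ×ˢ univ, max (v z - c) 0 ^ 2 ≤
      A * M ^ N * (2 * ∫ z in superlevel T v c, h z) := by
  have hv := H.contDiff.continuous
  have hh := H.continuous_grad
  have hcs := H.hasCompactSupport_truncation hc 0
  simp only [zero_add, pow_one] at hcs
  have hi1 : Integrable (fun z => max (v z - c) 0 ^ 2) volume :=
    Continuous.integrable_of_hasCompactSupport (by fun_prop) (H.hasCompactSupport_truncation hc 1)
  have hi2 : Integrable (fun z => 2 * max (v z - c) 0 * h z) volume :=
    Continuous.integrable_of_hasCompactSupport (by fun_prop)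
      (HasCompactSupport.mul_right (hcs.mul_left (f := fun _ => (2 : ℝ))))
  have hSm := measurableSet_superlevel hv T c
  have hi3 : IntegrableOn h (superlevel T v c) :=
    (hh.continuousOn.integrableOn_compact isCompact_box).mono_set
      fun z hz => H.mem_box (hc.trans_lt hz.2)
  -- Sobolev is applied to the squared truncation, the lowest `C¹` power. Its support is the slice
  -- of the superlevel set and its gradient is at most `2 (v - c)₊ h`.
  have hslice : ∀ t ≤ T, ∫ x, max (v (t, x) - c) 0 ^ 2 ≤
      A * M ^ N * ∫ x, 2 * max (v (t, x) - c) 0 * h (t, x) := by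
    intro t ht
    set w : E n → ℝ := fun x => max (v (t, x) - c) 0 ^ 2 with hw
    have hVc : ContDiff ℝ 1 fun z => max (v z - c) 0 ^ 2 := contDiff_truncation H.contDiff c 0
    have hwc : ContDiff ℝ 1 w := hVc.comp (by fun_prop : ContDiff ℝ 1 fun x : E n => (t, x))
    have hsupp : Function.support w = {x | c < v (t, x)} := by
      ext x
      simp [hw]
    have hgrad : ∀ x, ‖fderiv ℝ w x‖ ≤ 2 * max (v (t, x) - c) 0 * h (t, x) := by
      intro x
      have h0 := H.grad_nonneg (t, x)
      refine ContinuousLinearMap.opNorm_le_bound _ (by positivity) fun e => ?_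
      have e1 := spaceDeriv_eq_fderiv_slice (hVc.differentiable one_ne_zero) t x e
      rw [← e1]
      have e2 := fderiv_truncation H.contDiff c 0 (t, x)
      simp only [zero_add, CharP.cast_eq_zero, pow_one] at e2
      rw [spaceDeriv, e2]
      rcases le_or_gt (v (t, x)) c with hvc | hvc
      · have : max (v (t, x) - c) 0 = 0 := max_eq_right (by linarith)
        simp [this]
      · have := H.spaceDeriv_le (t, x) ht (hc.trans_lt hvc) e
        rw [smul_apply, smul_eq_mul, norm_mul, Real.norm_of_nonneg (by positivity), mul_assoc _ (h _)]
        exact mul_le_mul_of_nonneg_left this (by positivity)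
    have hcs' : HasCompactSupport fun x => 2 * max (v (t, x) - c) 0 * h (t, x) :=
      (HasCompactSupport.mul_right (hcs.mul_left (f := fun _ => (2 : ℝ)))
        (f' := h)).comp_isClosedEmbedding (isClosedEmbedding_prodMk_left t)
    refine (hS w hwc (fun x => by positivity) fun x hx => ?_).trans ?_
    · have := H.nonpos_of_space (t, x) hx
      simp only [hw]
      rw [max_eq_right (by linarith)]
      norm_num
    · rw [hsupp]
      have h1 := hM t ht
      have h2 : ∫ x, ‖fderiv ℝ w x‖ ≤ ∫ x, 2 * max (v (t, x) - c) 0 * h (t, x) := by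
        refine integral_mono_of_nonneg (Filter.Eventually.of_forall fun x => norm_nonneg _) ?_
          (Filter.Eventually.of_forall hgrad)
        exact Continuous.integrable_of_hasCompactSupport (by fun_prop) hcs'
      have h3 : 0 ≤ M := measureReal_nonneg.trans h1
      gcongr
  have hM0 : 0 ≤ M := measureReal_nonneg.trans (hM T le_rfl)
  calc ∫ z in Iic T ×ˢ univ, max (v z - c) 0 ^ 2
      = ∫ t in Iic T, ∫ x, max (v (t, x) - c) 0 ^ 2 := by
        rw [Measure.volume_eq_prod] at *
        rw [setIntegral_prod _ hi1.integrableOn]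
        simp
    _ ≤ ∫ t in Iic T, A * M ^ N * ∫ x, 2 * max (v (t, x) - c) 0 * h (t, x) := by
        rw [Measure.volume_eq_prod] at hi1 hi2
        exact setIntegral_mono_on hi1.integral_prod_left.integrableOn
          (hi2.integral_prod_left.const_mul _).integrableOn measurableSet_Iic hslice
    _ = A * M ^ N * ∫ z in Iic T ×ˢ univ, 2 * max (v z - c) 0 * h z := by
        rw [Measure.volume_eq_prod] at *
        rw [integral_const_mul, setIntegral_prod _ hi2.integrableOn]
        simp
    _ ≤ A * M ^ N * (2 * ∫ z in superlevel T v c, h z) := by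
        refine mul_le_mul_of_nonneg_left ?_ (by positivity)
        rw [← integral_const_mul, ← integral_indicator hSm]
        have hi4 : Integrable ((superlevel T v c).indicator fun z => 2 * h z) volume :=
          (integrable_indicator_iff hSm).2 (hi3.const_mul 2)
        refine (setIntegral_mono_on hi2.integrableOn hi4.integrableOn
          (measurableSet_Iic.prod MeasurableSet.univ) fun z hz => ?_).trans
          (setIntegral_le_integral hi4 (Filter.Eventually.of_forall
            (indicator_nonneg fun z _ => mul_nonneg zero_le_two (H.grad_nonneg z))))
        rcases le_or_gt (v z) c with hvc | hvc
        · rw [max_eq_right (by linarith)]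
          simp only [mul_zero, zero_mul]
          exact indicator_nonneg (fun z _ => mul_nonneg zero_le_two (H.grad_nonneg z)) z
        · rw [indicator_of_mem (show z ∈ superlevel T v c from ⟨hz.1, hvc⟩)]
          have h0 := H.grad_nonneg z
          have : max (v z - c) 0 ≤ 1 := max_le (by linarith [H.le_one z]) zero_le_one
          nlinarith

end IsRegularSubsolution

/-! ### De Giorgi's iteration. -/

/-- The nonlinear iteration inequality for the measures of superlevel sets. -/
theorem exists_measureReal_superlevel_le (hn : 1 ≤ n) {l K p m : ℝ} (hl : 0 < l) (hK : 0 < K)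
    (hp : 2 < p) (hm : 1 < m) :
    ∃ (C : ℝ) (q : ℕ), 0 < C ∧ 0 < q ∧ ∀ (T : ℝ) (v h F : ℝ × E n → ℝ) (G : ℝ × E n → E n),
      IsRegularSubsolution T l K p m v h F G → volume.real (superlevel T v 0) ≤ 1 →
      ∀ c d : ℝ, 0 ≤ c → 0 < d → d ≤ 1 →
        volume.real (superlevel T v (c + d)) ≤ C * d⁻¹ ^ q *
          volume.real (superlevel T v c) ^
            ((1 - 1 / m) * (1 / max (n : ℝ) 2 + 1 / p) + (1 - 1 / p)) := by
  obtain ⟨k, hk⟩ := exists_nat_ge (p / (p - 2))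
  -- The coefficient `(k + 2) * K` combines the factor from differentiating the truncation with the
  -- flux bound; `l / 2` leaves half of the Hamiltonian on the left.
  obtain ⟨C₁, hC₁, habs⟩ := exists_absorption hp k (by linarith) (a := (k + 2) * K) (l := l / 2)
    (by positivity) (by positivity)
  obtain ⟨A, hA, hSob⟩ := exists_integral_le_measure_support_rpow n hn (3 / 2)
  set N : ℝ := max (n : ℝ) 2 with hN
  have hN2 : 2 ≤ N := le_max_right _ _
  have hN0 : 0 < N := by linarith
  have hp0 : 0 < p := by linarith
  have hm0 : 0 < m := by linarith
  have hN1 : 1 / N ≤ 1 := by rw [div_le_one hN0]; linarith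
  have hp1 : 1 / p ≤ 1 := by rw [div_le_one hp0]; linarith
  have hm1 : 1 / m ≤ 1 := by rw [div_le_one hm0]; linarith
  have hm0' : 0 < 1 / m := by positivity
  set B := C₁ + K with hB
  -- The three Chebyshev losses: final superlevel set, slice measure, weighted gradient. The roots
  -- `1 / N` and `1 / p` on the last two are dropped because `y ≥ 1`.
  set q := 2 + (k + 3) + (k + 2) with hq
  refine ⟨2 * A * ((k + 3) * B) ^ (1 / N) * (2 / l * B) ^ (1 / p) * 2 ^ q, q, by positivity,
    by omega, ?_⟩
  intro T v h F G H h1 c d hc hd hd1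
  set U := volume.real (superlevel T v c) with hU
  have hfin := H.measure_superlevel_ne_top hc
  have hmono : volume.real (superlevel T v (c + d)) ≤ U :=
    measureReal_mono (superlevel_anti T v (by linarith)) hfin
  have hU1 : U ≤ 1 := (measureReal_mono (superlevel_anti T v hc)
    (H.measure_superlevel_ne_top le_rfl)).trans h1
  rcases (measureReal_nonneg : 0 ≤ U).eq_or_lt with hU0 | hU0
  · rw [hU, ← hU0] at hmono
    exact hmono.trans (by positivity)
  set X := U ^ (1 - 1 / m) with hX
  have hX0 : 0 < X := by positivity
  -- Since `U ≤ 1`, the absorption error `C₁ * U` is no worse than the source term.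
  have hUX : U ≤ X := by
    conv_lhs => rw [← Real.rpow_one U]
    exact Real.rpow_le_rpow_of_exponent_ge hU0 hU1 (by linarith)
  -- The gap is halved: the energy is used to reach level `c + d / 2`, and the last Chebyshev
  -- estimate reaches `c + d`.
  set y := (d / 2)⁻¹ with hy
  have hd2 : 0 < d / 2 := by linarith
  have hy1 : 1 ≤ y := by rw [hy, one_le_inv₀ hd2]; linarith
  have hy0 : 0 < y := by linarith
  have hyd : y * (d / 2) = 1 := inv_mul_cancel₀ hd2.ne'
  have hdiv : ∀ (j : ℕ) (a b : ℝ), (d / 2) ^ j * a ≤ b → a ≤ y ^ j * b := by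
    intro j a b hab
    calc a = y ^ j * ((d / 2) ^ j * a) := by
          rw [← mul_assoc, ← mul_pow, hyd, one_pow, one_mul]
      _ ≤ y ^ j * b := by gcongr
  have hen : ∀ t ≤ T, (k + 3 : ℝ)⁻¹ * (∫ x, max (v (t, x) - c) 0 ^ (k + 3)) +
      (l / 2) * ∫ z in Iic t ×ˢ univ, h z ^ p * max (v z - c) 0 ^ (k + 2) ≤ B * X := by
    intro t ht
    refine (H.energy hp hC₁ habs hc ht).trans ?_
    rw [hB, add_mul]
    gcongr
  have hMt : ∀ t ≤ T, volume.real {x | c + d / 2 < v (t, x)} ≤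
      y ^ (k + 3) * ((k + 3) * B * X) := by
    intro t ht
    refine hdiv _ _ _ ((H.measureReal_slice_le hc hd2 (k + 2) t).trans ?_)
    have h2 : 0 ≤ (l / 2) * ∫ z in Iic t ×ˢ univ, h z ^ p * max (v z - c) 0 ^ (k + 2) :=
      mul_nonneg (by linarith) (integral_nonneg fun z => mul_nonneg
        (Real.rpow_nonneg (H.grad_nonneg z) p) (by positivity))
    have h3 : (k + 3 : ℝ)⁻¹ * (∫ x, max (v (t, x) - c) 0 ^ (k + 3)) ≤ B * X := by
      linarith [hen t ht]
    rw [inv_mul_le_iff₀ (by positivity)] at h3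
    linarith
  have hgp : ∫ z in superlevel T v (c + d / 2), h z ^ p ≤ y ^ (k + 2) * (2 / l * B * X) := by
    refine hdiv _ _ _ ((H.setIntegral_grad_rpow_le hp hc hd2 (k + 1)).trans ?_)
    have h2 : 0 ≤ (k + 3 : ℝ)⁻¹ * (∫ x, max (v (T, x) - c) 0 ^ (k + 3)) := by
      have : 0 ≤ ∫ x, max (v (T, x) - c) 0 ^ (k + 3) := integral_nonneg fun x => by positivity
      positivity
    have h3 : (l / 2) * ∫ z in Iic T ×ˢ univ, h z ^ p * max (v z - c) 0 ^ (k + 2) ≤ B * X := by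
      linarith [hen T le_rfl]
    calc ∫ z in Iic T ×ˢ univ, h z ^ p * max (v z - c) 0 ^ (k + 2)
        = 2 / l * ((l / 2) * ∫ z in Iic T ×ˢ univ, h z ^ p * max (v z - c) 0 ^ (k + 2)) := by
          field_simp
      _ ≤ 2 / l * (B * X) := by gcongr
      _ = _ := by ring
  have hc' : 0 ≤ c + d / 2 := by linarith
  have hfin' := H.measure_superlevel_ne_top hc'
  have hhp : Continuous fun z => h z ^ p :=
    H.continuous_grad.rpow_const fun _ => Or.inr (by linarith)
  have hh : ∫ z in superlevel T v (c + d / 2), h z ≤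
      (y ^ (k + 2) * (2 / l * B * X)) ^ (1 / p) * U ^ (1 - 1 / p) := by
    refine (setIntegral_le_rpow_mul_rpow hfin' (p := p) (by linarith) H.grad_nonneg
      H.continuous_grad.aestronglyMeasurable ?_).trans ?_
    · exact (hhp.continuousOn.integrableOn_compact IsRegularSubsolution.isCompact_box).mono_set
        fun z hz => H.mem_box (hc'.trans_lt hz.2)
    · have h5 : volume.real (superlevel T v (c + d / 2)) ≤ U :=
        measureReal_mono (superlevel_anti T v (by linarith)) hfin
      have h6 : 0 ≤ ∫ z in superlevel T v (c + d / 2), h z ^ p :=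
        integral_nonneg fun z => Real.rpow_nonneg (H.grad_nonneg z) p
      have h7 : 0 ≤ 1 - 1 / p := by linarith
      gcongr
  have hsq := H.setIntegral_truncation_sq_le hA.le (by positivity) hSob hc' hMt
  have hfinal := hdiv 2 _ _ ((H.measureReal_superlevel_le hc' hd2 1).trans hsq)
  rw [show c + d / 2 + d / 2 = c + d by ring] at hfinal
  have hroot : ∀ (j : ℕ) (a r : ℝ), 0 ≤ a → 0 ≤ r → r ≤ 1 →
      (y ^ j * (a * X)) ^ r ≤ y ^ j * (a ^ r * X ^ r) := by
    intro j a r ha hr0 hr1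
    rw [Real.mul_rpow (by positivity) (by positivity), Real.mul_rpow ha hX0.le]
    gcongr
    conv_rhs => rw [← Real.rpow_one (y ^ j)]
    exact Real.rpow_le_rpow_of_exponent_le (one_le_pow₀ hy1) hr1
  have r1 := hroot (k + 3) ((k + 3) * B) (1 / N) (by positivity) (by positivity) hN1
  have r2 := hroot (k + 2) (2 / l * B) (1 / p) (by positivity) (by positivity) hp1
  have hpow : X ^ (1 / N) * X ^ (1 / p) * U ^ (1 - 1 / p) =
      U ^ ((1 - 1 / m) * (1 / N + 1 / p) + (1 - 1 / p)) := by
    rw [← Real.rpow_add hX0, hX, ← Real.rpow_mul hU0.le, ← Real.rpow_add hU0]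
  have hy2 : y = 2 * d⁻¹ := by rw [hy]; field_simp
  calc volume.real (superlevel T v (c + d))
      ≤ y ^ 2 * (A * (y ^ (k + 3) * ((k + 3) * B * X)) ^ (1 / N) *
          (2 * ∫ z in superlevel T v (c + d / 2), h z)) := hfinal
    _ ≤ y ^ 2 * (A * (y ^ (k + 3) * (((k + 3) * B) ^ (1 / N) * X ^ (1 / N))) *
          (2 * ((y ^ (k + 2) * ((2 / l * B) ^ (1 / p) * X ^ (1 / p))) * U ^ (1 - 1 / p)))) := by
        have h8 : 0 ≤ ∫ z in superlevel T v (c + d / 2), h z :=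
          integral_nonneg fun z => H.grad_nonneg z
        have h9 : ∫ z in superlevel T v (c + d / 2), h z ≤
            (y ^ (k + 2) * ((2 / l * B) ^ (1 / p) * X ^ (1 / p))) * U ^ (1 - 1 / p) :=
          hh.trans (by gcongr)
        gcongr
    _ = 2 * A * ((k + 3) * B) ^ (1 / N) * (2 / l * B) ^ (1 / p) * y ^ q *
          (X ^ (1 / N) * X ^ (1 / p) * U ^ (1 - 1 / p)) := by
        rw [hq, pow_add, pow_add]; ring
    _ = _ := by rw [hpow, hy2, mul_pow]; ring

/-- De Giorgi's lemma for regular subsolutions. -/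
theorem exists_le_of_measureReal_superlevel_le (hn : 1 ≤ n) {l K p m : ℝ} (hl : 0 < l)
    (hK : 0 < K) (hp : 2 < p) (hm : 1 + max (n : ℝ) 2 / p < m) :
    ∃ δ : ℝ, 0 < δ ∧ ∀ (T : ℝ) (v h F : ℝ × E n → ℝ) (G : ℝ × E n → E n),
      IsRegularSubsolution T l K p m v h F G → volume.real (superlevel T v 0) ≤ δ →
      ∀ z, z.1 < T → v z ≤ 1 / 5 := by
  set N : ℝ := max (n : ℝ) 2 with hN
  have hN2 : 2 ≤ N := le_max_right _ _
  have hp0 : 0 < p := by linarith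
  have hNp : 0 < N / p := by positivity
  have hm1 : 1 < m := by linarith
  obtain ⟨C, q, hC, hq, hstep⟩ := exists_measureReal_superlevel_le hn hl hK hp hm1
  set σ := (1 - 1 / m) * (1 / N + 1 / p) - 1 / p with hσ
  have hσ0 : 0 < σ := by
    -- Positivity of the gain is equivalent to the lower bound on `m`.
    have e : σ = (m - (1 + N / p)) / (m * N) := by
      rw [hσ]; field_simp; ring
    rw [e]
    have : 0 < m - (1 + N / p) := by linarith
    positivity
  have hB : (1 : ℝ) < 2 ^ q := one_lt_pow₀ one_lt_two hq.ne'
  obtain ⟨δ, hδ, hconv⟩ := tendsto_zero_of_le_mul_rpow (C := C * 10 ^ q) (by positivity) hB hσ0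
  refine ⟨min δ 1, by positivity, fun T v h F G H hsmall z hz => ?_⟩
  -- The levels rise from `0` to `1 / 5` with gaps `1 / (10 * 2 ^ k)`, whence the factors `10 ^ q`
  -- and `(2 ^ q) ^ k`.
  set c : ℕ → ℝ := fun k => 1 / 5 * (1 - (2 ^ k)⁻¹) with hc
  have hc0 : ∀ k, 0 ≤ c k := fun k => by
    have : ((2 : ℝ) ^ k)⁻¹ ≤ 1 := inv_le_one_of_one_le₀ (one_le_pow₀ one_le_two)
    simp only [hc]
    linarith
  have hlim := hconv (fun k => volume.real (superlevel T v (c k))) (fun k => measureReal_nonneg)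
    (by simpa [hc] using hsmall.trans (min_le_left _ _)) fun k => by
      have hd : (0 : ℝ) < (10 * 2 ^ k)⁻¹ := by positivity
      have hd1 : ((10 : ℝ) * 2 ^ k)⁻¹ ≤ 1 := inv_le_one_of_one_le₀ (by
        have : (1 : ℝ) ≤ 2 ^ k := one_le_pow₀ one_le_two
        linarith)
      have := hstep T v h F G H (hsmall.trans (min_le_right _ _)) (c k) _ (hc0 k) hd hd1
      have e1 : c k + (10 * 2 ^ k)⁻¹ = c (k + 1) := by
        simp only [hc]; field_simp; ring
      have e2 : (1 - 1 / m) * (1 / N + 1 / p) + (1 - 1 / p) = 1 + σ := by rw [hσ]; ring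
      rw [e1, inv_inv, mul_pow, e2] at this
      refine this.trans (le_of_eq ?_)
      rw [← pow_mul, ← pow_mul, mul_comm q k]
      ring
  by_contra! hvz
  have hv := H.contDiff.continuous
  -- Null measure becomes emptiness by continuity; the strict time inequality makes `O` open.
  set O : Set (ℝ × E n) := {z | z.1 < T ∧ 1 / 5 < v z} with hO
  have hOo : IsOpen O := (isOpen_lt continuous_fst continuous_const).inter
    (isOpen_lt continuous_const hv)
  have hOpos : 0 < volume O := hOo.measure_pos volume ⟨z, hz, hvz⟩
  have hOsub : ∀ k, O ⊆ superlevel T v (c k) := fun k z hz => ⟨hz.1.le, by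
    have : (0 : ℝ) < (2 ^ k)⁻¹ := by positivity
    have h2 := hz.2
    simp only [hc]
    linarith⟩
  have hOfin : volume O ≠ ⊤ :=
    ((measure_mono (hOsub 0)).trans_lt (H.measure_superlevel_ne_top (hc0 0)).lt_top).ne
  have hle : volume.real O ≤ 0 := ge_of_tendsto' hlim fun k =>
    measureReal_mono (hOsub k) (H.measure_superlevel_ne_top (hc0 k))
  exact absurd (ENNReal.toReal_pos hOpos.ne' hOfin) (not_lt.2 hle)

/-! ### Mollification. -/

section Mollification

variable {P : Type*} [NormedAddCommGroup P] [NormedSpace ℝ P] [FiniteDimensional ℝ P]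
  [MeasurableSpace P] {μ : Measure P}
  {V : Type*} [NormedAddCommGroup V] [NormedSpace ℝ V]

/-- The mollification of `g` by the normalized bump function `ρ`. -/
def mollify (ρ : ContDiffBump (0 : P)) (μ : Measure P) (g : P → V) : P → V :=
  convolution (ρ.normed μ) g (ContinuousLinearMap.lsmul ℝ ℝ) μ

variable (ρ : ContDiffBump (0 : P))

/-- The bump function `y ↦ ρ (z - y)`, normalized. -/
def reflectedBump (μ : Measure P) (z : P) : P → ℝ := fun y => ρ.normed μ (z - y)

theorem reflectedBump_nonneg (z y : P) : 0 ≤ reflectedBump ρ μ z y := ρ.nonneg_normed _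

theorem contDiff_reflectedBump (z : P) : ContDiff ℝ ∞ (reflectedBump ρ μ z) :=
  ρ.contDiff_normed.comp (contDiff_const.sub contDiff_id)

theorem fderiv_reflectedBump (z y w : P) :
    fderiv ℝ (reflectedBump ρ μ z) y w = - fderiv ℝ (ρ.normed μ) (z - y) w := by
  have h : HasFDerivAt (fun y => z - y) (-ContinuousLinearMap.id ℝ P) y :=
    (hasFDerivAt_id y).const_sub z
  have hd : DifferentiableAt ℝ (ρ.normed μ) (z - y) :=
    ((ρ.contDiff_normed (n := 1)).differentiable one_ne_zero) _
  have := (hd.hasFDerivAt.comp y h).fderiv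
  unfold reflectedBump
  rw [show (fun y => ρ.normed μ (z - y)) = ρ.normed μ ∘ fun y => z - y from rfl, this]
  simp

variable [BorelSpace P] [μ.IsAddHaarMeasure]

theorem tsupport_reflectedBump (z : P) :
    tsupport (reflectedBump ρ μ z) ⊆ closedBall z ρ.rOut := by
  refine closure_minimal (fun y hy => ?_) isClosed_closedBall
  have : z - y ∈ Function.support (ρ.normed μ) := hy
  rw [ρ.support_normed_eq, mem_ball_zero_iff] at this
  rw [mem_closedBall, dist_comm, dist_eq_norm]
  exact this.le

theorem hasCompactSupport_reflectedBump (z : P) : HasCompactSupport (reflectedBump ρ μ z) :=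
  HasCompactSupport.of_support_subset_isCompact (isCompact_closedBall z ρ.rOut)
    ((subset_tsupport _).trans (tsupport_reflectedBump ρ z))

theorem integral_reflectedBump (z : P) : ∫ y, reflectedBump ρ μ z y ∂μ = 1 := by
  unfold reflectedBump
  rw [integral_sub_left_eq_self (ρ.normed μ) μ z]
  exact ρ.integral_normed

theorem mollify_apply (g : P → V) (z : P) :
    mollify ρ μ g z = ∫ y, reflectedBump ρ μ z y • g y ∂μ := by
  unfold mollify
  rw [convolution_eq_swap]
  rfl

theorem integrable_reflectedBump_smul {g : P → V} (hg : LocallyIntegrable g μ) (z : P) :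
    Integrable (fun y => reflectedBump ρ μ z y • g y) μ :=
  hg.integrable_smul_left_of_hasCompactSupport (contDiff_reflectedBump ρ z).continuous
    (hasCompactSupport_reflectedBump ρ z)

theorem contDiff_mollify {g : P → V} (hg : LocallyIntegrable g μ) :
    ContDiff ℝ 1 (mollify ρ μ g) :=
  ρ.hasCompactSupport_normed.contDiff_convolution_left _ (ρ.contDiff_normed (n := 1)) hg

/-- Putting the derivative on the bump makes it a pairing with a test function, the form in which
the weak hypotheses apply. The sign comes from the reflection. -/
theorem fderiv_mollify {g : P → ℝ} (hg : LocallyIntegrable g μ) (z w : P) :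
    fderiv ℝ (mollify ρ μ g) z w = - ∫ y, g y * fderiv ℝ (reflectedBump ρ μ z) y w ∂μ := by
  have hc := ρ.hasCompactSupport_normed (μ := μ)
  have hd := ρ.contDiff_normed (n := 1) (μ := μ)
  have h := hc.hasFDerivAt_convolution_left (ContinuousLinearMap.lsmul ℝ ℝ) hd hg z
  unfold mollify
  rw [h.fderiv, convolution_eq_swap, ContinuousLinearMap.integral_apply]
  · rw [← integral_neg]
    refine integral_congr_ae (Filter.Eventually.of_forall fun y => ?_)
    simp only [fderiv_reflectedBump]
    simp [ContinuousLinearMap.precompL_apply, mul_comm]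
  · exact (((hc.fderiv ℝ).convolutionExists_left _
      (hd.continuous_fderiv one_ne_zero) hg) z).integrable_swap

theorem mollify_nonneg {g : P → ℝ} (hg : ∀ y, 0 ≤ g y) (z : P) : 0 ≤ mollify ρ μ g z := by
  rw [mollify_apply]
  exact integral_nonneg fun y => smul_nonneg (reflectedBump_nonneg ρ z y) (hg y)

theorem mollify_mono {f g : P → ℝ} (hf : LocallyIntegrable f μ) (hg : LocallyIntegrable g μ)
    (h : ∀ᵐ y ∂μ, f y ≤ g y) (z : P) : mollify ρ μ f z ≤ mollify ρ μ g z := by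
  rw [mollify_apply, mollify_apply]
  refine integral_mono_ae (integrable_reflectedBump_smul ρ hf z)
    (integrable_reflectedBump_smul ρ hg z) (h.mono fun y hy => ?_)
  exact mul_le_mul_of_nonneg_left hy (reflectedBump_nonneg ρ z y)

theorem mollify_const (c : ℝ) (z : P) : mollify ρ μ (fun _ => c) z = c := by
  rw [mollify_apply]
  simp [integral_mul_const, integral_reflectedBump]

theorem norm_mollify_le (g : P → V) (z : P) :
    ‖mollify ρ μ g z‖ ≤ mollify ρ μ (fun y => ‖g y‖) z := by
  rw [mollify_apply, mollify_apply]
  refine (norm_integral_le_integral_norm _).trans (le_of_eq ?_)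
  refine integral_congr_ae (Filter.Eventually.of_forall fun y => ?_)
  simp [norm_smul, abs_of_nonneg (reflectedBump_nonneg ρ z y)]

theorem integrable_mollify {g : P → ℝ} (hg : Integrable g μ) : Integrable (mollify ρ μ g) μ :=
  ρ.integrable_normed.integrable_convolution _ hg

theorem integral_mollify {g : P → ℝ} (hg : Integrable g μ) :
    ∫ z, mollify ρ μ g z ∂μ = ∫ z, g z ∂μ := by
  unfold mollify
  rw [integral_convolution _ ρ.integrable_normed hg, ρ.integral_normed]
  simp

/-- Jensen's inequality for mollifications. -/
theorem mollify_rpow_le {g : P → ℝ} {r : ℝ} (hr : 1 ≤ r) (hg0 : ∀ y, 0 ≤ g y)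
    (hg : LocallyIntegrable g μ) (hgr : LocallyIntegrable (fun y => g y ^ r) μ) (z : P) :
    mollify ρ μ g z ^ r ≤ mollify ρ μ (fun y => g y ^ r) z := by
  set η : P → NNReal := fun y => (reflectedBump ρ μ z y).toNNReal with hη
  have hηm : Measurable η := (contDiff_reflectedBump ρ z).continuous.measurable.real_toNNReal
  -- Averaging against the bump is integration for a probability measure, so Jensen's inequality
  -- applies.
  set ν := μ.withDensity fun y => (η y : ℝ≥0∞) with hν
  have hηs : ∀ f : P → ℝ, (fun y => η y • f y) = fun y => reflectedBump ρ μ z y • f y := fun f => by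
    funext y
    rw [NNReal.smul_def, Real.coe_toNNReal _ (reflectedBump_nonneg ρ z y)]
  have hint : ∀ f : P → ℝ, ∫ y, f y ∂ν = mollify ρ μ f z := fun f => by
    rw [hν, integral_withDensity_eq_integral_smul hηm, hηs, mollify_apply]
  have hprob : IsProbabilityMeasure ν := by
    refine ⟨?_⟩
    rw [hν, withDensity_apply _ MeasurableSet.univ, Measure.restrict_univ]
    have : ∀ y, (η y : ℝ≥0∞) = ENNReal.ofReal (reflectedBump ρ μ z y) := fun y => rfl
    simp only [this]
    rw [← ofReal_integral_eq_lintegral_ofReal, integral_reflectedBump, ENNReal.ofReal_one]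
    · exact (contDiff_reflectedBump ρ z).continuous.integrable_of_hasCompactSupport
        (hasCompactSupport_reflectedBump ρ z)
    · exact Filter.Eventually.of_forall (reflectedBump_nonneg ρ z)
  have hi : ∀ f : P → ℝ, LocallyIntegrable f μ → Integrable f ν := fun f hf => by
    rw [hν, integrable_withDensity_iff_integrable_smul hηm, hηs]
    exact integrable_reflectedBump_smul ρ hf z
  have := (convexOn_rpow hr).map_integral_le (μ := ν) (f := g)
    (Real.continuous_rpow_const (by linarith)).continuousOn isClosed_Ici
    (Filter.Eventually.of_forall hg0) (hi g hg) (hi _ hgr)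
  rwa [hint, hint] at this

end Mollification

/-! ### Mollifying the weak inequality. -/

theorem interior_cylinder (τ r : ℝ) :
    interior (cylinder n τ r) = Ioo (-τ) 0 ×ˢ ball (0 : E n) r := by
  rw [cylinder, interior_prod_eq, interior_Icc, isOpen_ball.interior_eq]

theorem measurableSet_cylinder (τ r : ℝ) : MeasurableSet (cylinder n τ r) :=
  measurableSet_Icc.prod measurableSet_ball

theorem volume_cylinder_lt_top (τ r : ℝ) : volume (cylinder n τ r) < ⊤ := by
  refine (measure_mono (t := Icc (-τ) 0 ×ˢ closedBall (0 : E n) r) ?_).trans_lt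
    (isCompact_Icc.prod (isCompact_closedBall _ _)).measure_lt_top
  exact prod_mono_right ball_subset_closedBall

theorem matAct_apply (M : Matrix (Fin n) (Fin n) ℝ) (x : E n) :
    matAct M x = WithLp.toLp 2 (M.mulVec (WithLp.ofLp x)) := rfl

theorem continuous_matAct :
    Continuous fun q : Matrix (Fin n) (Fin n) ℝ × E n => matAct q.1 q.2 := by
  simp only [matAct_apply]
  refine (PiLp.continuous_toLp 2 _).comp ?_
  exact continuous_fst.matrix_mulVec ((PiLp.continuous_ofLp 2 _).comp continuous_snd)

theorem spaceDiv_mollify (ρ : ContDiffBump (0 : ℝ × E n)) {V : ℝ × E n → E n}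
    (hV : Integrable V) (z : ℝ × E n) :
    spaceDiv (mollify ρ volume V) z =
      - ∫ y, spaceDeriv (reflectedBump ρ volume z) y (V y) := by
  have hVi : ∀ i, Integrable fun y => V y i := fun i =>
    (EuclideanSpace.proj (𝕜 := ℝ) i).integrable_comp hV
  have hcomp : ∀ i, (fun z => mollify ρ volume V z i) = mollify ρ volume fun y => V y i := by
    intro i
    funext z
    rw [mollify_apply, mollify_apply]
    exact ((EuclideanSpace.proj (𝕜 := ℝ) i).integral_comp_comm
      (integrable_reflectedBump_smul ρ hV.locallyIntegrable z)).symm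
  have hsum : ∀ y, spaceDeriv (reflectedBump ρ volume z) y (V y) =
      ∑ i, V y i * fderiv ℝ (reflectedBump ρ volume z) y (0, EuclideanSpace.single i 1) :=
    fun y => spaceDeriv_eq_sum _ y (V y)
  simp only [spaceDiv, hcomp, hsum]
  rw [integral_finsetSum, ← Finset.sum_neg_distrib]
  · exact Finset.sum_congr rfl fun i _ => fderiv_mollify ρ (hVi i).locallyIntegrable z _
  · intro i _
    have hc : Continuous fun y => fderiv ℝ (reflectedBump ρ volume z) y
        (0, EuclideanSpace.single i 1) :=
      ((contDiff_reflectedBump ρ z).continuous_fderiv (by simp)).clm_apply continuous_const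
    have hcs : HasCompactSupport fun y => fderiv ℝ (reflectedBump ρ volume z) y
        (0, EuclideanSpace.single i 1) :=
      ((hasCompactSupport_reflectedBump ρ z).fderiv ℝ).comp_left
        (g := fun L : ℝ × E n →L[ℝ] ℝ => L (0, EuclideanSpace.single i 1)) (by simp)
    have := (hVi i).locallyIntegrable.integrable_smul_left_of_hasCompactSupport hc hcs
    simpa [mul_comm] using this

theorem isTestFunction_reflectedBump (ρ : ContDiffBump (0 : ℝ × E n)) {Q : Set (ℝ × E n)}
    {z : ℝ × E n} (hz : closedBall z ρ.rOut ⊆ interior Q) :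
    IsTestFunction Q (reflectedBump ρ volume z) :=
  ⟨contDiff_reflectedBump ρ z, hasCompactSupport_reflectedBump ρ z,
    (tsupport_reflectedBump ρ z).trans hz⟩

theorem setIntegral_mul_eq_integral_indicator {α : Type*} [MeasurableSpace α] {μ : Measure α}
    {Q : Set α} (hQ : MeasurableSet Q) (f g : α → ℝ) :
    ∫ y in Q, f y * g y ∂μ = ∫ y, Q.indicator f y * g y ∂μ := by
  rw [← integral_indicator hQ]
  simp only [indicator_mul_left]

theorem spaceDeriv_mollify_le (ρ : ContDiffBump (0 : ℝ × E n)) {Q : Set (ℝ × E n)}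
    (hQ : MeasurableSet Q) {u : ℝ × E n → ℝ} {Du : ℝ × E n → E n}
    (hu : IntegrableOn u Q) (hDu : IntegrableOn Du Q) (hw : IsWeakSpatialGradient Q u Du)
    {z : ℝ × E n} (hz : closedBall z ρ.rOut ⊆ interior Q) (e : E n) :
    |spaceDeriv (mollify ρ volume (Q.indicator u)) z e| ≤
      mollify ρ volume (fun y => ‖Q.indicator Du y‖) z * ‖e‖ := by
  have hDi : Integrable (Q.indicator Du) := (integrable_indicator_iff hQ).2 hDu
  have hui : Integrable (Q.indicator u) := (integrable_indicator_iff hQ).2 hu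
  have h := hw _ (isTestFunction_reflectedBump ρ hz) e
  rw [spaceDeriv, fderiv_mollify ρ hui.locallyIntegrable, ← setIntegral_mul_eq_integral_indicator hQ,
    abs_neg]
  change |∫ y in Q, u y * spaceDeriv (reflectedBump ρ volume z) y e| ≤ _
  rw [h, abs_neg, setIntegral_mul_eq_integral_indicator hQ, mollify_apply, ← integral_mul_const]
  refine (abs_integral_le_integral_abs).trans (integral_mono_of_nonneg
    (Filter.Eventually.of_forall fun y => abs_nonneg _) ?_ (Filter.Eventually.of_forall fun y => ?_))
  · exact (integrable_reflectedBump_smul ρ hDi.norm.locallyIntegrable z).mul_const _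
  · have h0 := reflectedBump_nonneg ρ (μ := volume) z y
    simp only [abs_mul, abs_of_nonneg h0, smul_eq_mul]
    by_cases hy : y ∈ Q
    · simp only [indicator_of_mem hy]
      have := abs_real_inner_le_norm (Du y) e
      calc _ ≤ ‖Du y‖ * ‖e‖ * reflectedBump ρ volume z y := by gcongr
        _ = _ := by ring
    · simp [indicator_of_notMem hy]

/-- The reflected bump centred at `z` is an admissible test function. Linear terms commute with the
averaging, and Jensen moves the power `p` outside the average in the favourable direction. -/
theorem mollify_inequality (ρ : ContDiffBump (0 : ℝ × E n)) {Q : Set (ℝ × E n)}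
    (hQ : MeasurableSet Q) {u f : ℝ × E n → ℝ} {Du : ℝ × E n → E n}
    {A : ℝ × E n → Matrix (Fin n) (Fin n) ℝ} {Λ p : ℝ} (hΛ : 0 < Λ) (hp : 2 < p)
    (hu : IntegrableOn u Q) (hDu : IntegrableOn Du Q) (hDp : IntegrableOn (fun y => ‖Du y‖ ^ p) Q)
    (hV : IntegrableOn (fun y => matAct (A y) (Du y)) Q) (hf : IntegrableOn f Q)
    (hs : ∀ φ : ℝ × E n → ℝ, IsTestFunction Q φ → (∀ z, 0 ≤ φ z) →
      - (∫ z in Q, u z * timeDeriv φ z) + Λ⁻¹ * (∫ z in Q, ‖Du z‖ ^ p * φ z)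
        + (∫ z in Q, spaceDeriv φ z (matAct (A z) (Du z))) ≤ ∫ z in Q, f z * φ z)
    {z : ℝ × E n} (hz : closedBall z ρ.rOut ⊆ interior Q) :
    timeDeriv (mollify ρ volume (Q.indicator u)) z +
        Λ⁻¹ * mollify ρ volume (fun y => ‖Q.indicator Du y‖) z ^ p ≤
      spaceDiv (mollify ρ volume (Q.indicator fun y => matAct (A y) (Du y))) z +
        mollify ρ volume (fun y => |Q.indicator f y|) z := by
  have hDi : Integrable (Q.indicator Du) := (integrable_indicator_iff hQ).2 hDu
  have hui : Integrable (Q.indicator u) := (integrable_indicator_iff hQ).2 hu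
  have hfi : Integrable (Q.indicator f) := (integrable_indicator_iff hQ).2 hf
  have hVi : Integrable (Q.indicator fun y => matAct (A y) (Du y)) :=
    (integrable_indicator_iff hQ).2 hV
  have hDe : (fun y => ‖Q.indicator Du y‖ ^ p) = Q.indicator fun y => ‖Du y‖ ^ p := by
    funext y
    by_cases hy : y ∈ Q
    · simp [hy]
    · simp [hy, Real.zero_rpow (by linarith : p ≠ 0)]
  have hDpi : Integrable fun y => ‖Q.indicator Du y‖ ^ p := by
    rw [hDe]
    exact (integrable_indicator_iff hQ).2 hDp
  have h := hs _ (isTestFunction_reflectedBump ρ hz) (reflectedBump_nonneg ρ z)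
  have e1 : timeDeriv (mollify ρ volume (Q.indicator u)) z =
      - ∫ y in Q, u y * timeDeriv (reflectedBump ρ volume z) y := by
    rw [timeDeriv, fderiv_mollify ρ hui.locallyIntegrable, setIntegral_mul_eq_integral_indicator hQ]
    rfl
  have e2 : mollify ρ volume (fun y => ‖Q.indicator Du y‖) z ^ p ≤
      ∫ y in Q, ‖Du y‖ ^ p * reflectedBump ρ volume z y := by
    refine (mollify_rpow_le ρ (by linarith) (fun y => norm_nonneg _) hDi.norm.locallyIntegrable
      hDpi.locallyIntegrable z).trans (le_of_eq ?_)
    rw [mollify_apply, setIntegral_mul_eq_integral_indicator hQ]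
    simp only [smul_eq_mul, mul_comm, ← hDe]
  have e3 : spaceDiv (mollify ρ volume (Q.indicator fun y => matAct (A y) (Du y))) z =
      - ∫ y in Q, spaceDeriv (reflectedBump ρ volume z) y (matAct (A y) (Du y)) := by
    rw [spaceDiv_mollify ρ hVi, ← integral_indicator hQ]
    congr 1
    refine integral_congr_ae (Filter.Eventually.of_forall fun y => ?_)
    by_cases hy : y ∈ Q
    · simp [hy]
    · have : ((0 : ℝ), (0 : E n)) = 0 := rfl
      simp [hy, spaceDeriv, this]
  have e4 : ∫ y in Q, f y * reflectedBump ρ volume z y ≤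
      mollify ρ volume (fun y => |Q.indicator f y|) z := by
    refine le_trans (le_of_eq ?_) (mollify_mono ρ hfi.locallyIntegrable hfi.norm.locallyIntegrable
      (Filter.Eventually.of_forall fun y => le_abs_self _) z)
    rw [mollify_apply, setIntegral_mul_eq_integral_indicator hQ]
    simp only [smul_eq_mul, mul_comm]
  have e5 := mul_le_mul_of_nonneg_left e2 (inv_pos.2 hΛ).le
  rw [e1, e3]
  linarith

/-! ### The barrier. -/

/-- A coercive barrier which forces truncations to have compact support. -/
def barrier (z : ℝ × E n) : ℝ := 1 / 10 * (z.1 ^ 6 + (‖z.2‖ ^ 2) ^ 3) + 1 / 10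

theorem contDiff_barrier : ContDiff ℝ 1 (barrier (n := n)) := by
  have : ContDiff ℝ 1 fun z : ℝ × E n => ‖z.2‖ ^ 2 := contDiff_snd.norm_sq ℝ
  unfold barrier
  fun_prop

theorem barrier_nonneg (z : ℝ × E n) : 0 ≤ barrier z := by
  have : (0 : ℝ) ≤ z.1 ^ 6 := by positivity
  unfold barrier
  positivity

/-- The sixth power is large enough: `(3 / 2) ^ 6 > 11`, while the same polynomial stays small on
the unit cylinder. -/
theorem one_le_barrier_of_time {z : ℝ × E n} (hz : 3 / 2 ≤ |z.1|) : 1 ≤ barrier z := by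
  have h : (3 / 2 : ℝ) ^ 6 ≤ |z.1| ^ 6 := by gcongr
  rw [Even.pow_abs (by decide)] at h
  have : (0 : ℝ) ≤ (‖z.2‖ ^ 2) ^ 3 := by positivity
  unfold barrier
  norm_num at h
  linarith

theorem one_le_barrier_of_space {z : ℝ × E n} (hz : 3 / 2 ≤ ‖z.2‖) : 1 ≤ barrier z := by
  have h : ((3 / 2 : ℝ) ^ 2) ^ 3 ≤ (‖z.2‖ ^ 2) ^ 3 := by gcongr
  have : (0 : ℝ) ≤ z.1 ^ 6 := by positivity
  unfold barrier
  norm_num at h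
  linarith

theorem barrier_le {z : ℝ × E n} (hz : z ∈ cylinder n 1 1) : barrier z ≤ 3 / 10 := by
  have h1 : z.1 ^ 6 ≤ 1 := by
    rw [← Even.pow_abs (by decide)]
    exact pow_le_one₀ (abs_nonneg _) (abs_le.2 ⟨hz.1.1, hz.1.2.trans zero_le_one⟩)
  have h2 : (‖z.2‖ ^ 2) ^ 3 ≤ 1 :=
    pow_le_one₀ (by positivity) (pow_le_one₀ (by positivity) (mem_ball_zero_iff.1 hz.2).le)
  unfold barrier
  linarith

theorem exists_norm_fderiv_barrier_le (n : ℕ) :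
    ∃ C : ℝ, 0 < C ∧ ∀ z ∈ Icc (-(3 / 2) : ℝ) (3 / 2) ×ˢ closedBall (0 : E n) (3 / 2),
      ‖fderiv ℝ (barrier (n := n)) z‖ ≤ C := by
  obtain ⟨C, hC⟩ := (isCompact_Icc.prod (isCompact_closedBall (0 : E n) (3 / 2))).exists_bound_of_continuousOn
    (f := fun z => fderiv ℝ (barrier (n := n)) z)
    (contDiff_barrier.continuous_fderiv one_ne_zero).continuousOn
  exact ⟨max C 1, by positivity, fun z hz => (hC z hz).trans (le_max_left _ _)⟩

/-- Stopping at time `-2 * r` keeps the bump strictly before time zero; the other sides have room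
because `3 / 2 + 1 / 4 < 2`. -/
theorem closedBall_subset_interior_cylinder {r : ℝ} (hr : r < 1 / 4) {z : ℝ × E n} (hr0 : 0 < r)
    (ht : -(3 / 2) ≤ z.1) (ht' : z.1 ≤ -2 * r) (hx : ‖z.2‖ ≤ 3 / 2) :
    closedBall z r ⊆ interior (cylinder n 2 2) := by
  intro y hy
  rw [mem_closedBall, Prod.dist_eq, max_le_iff, Real.dist_eq, abs_le, dist_eq_norm] at hy
  rw [interior_cylinder]
  refine ⟨⟨by linarith [hy.1.1], by linarith [hy.1.2]⟩, mem_ball_zero_iff.2 ?_⟩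
  have := norm_le_norm_add_norm_sub' y.2 z.2
  linarith [hy.2]

/-! ### Integrability and bounds for the mollified data. -/

theorem integrableOn_of_memLp {V : Type*} [NormedAddCommGroup V] {τ r p : ℝ} (hp : 1 ≤ p)
    {g : ℝ × E n → V} (hg : MemLp g (ENNReal.ofReal p) (volume.restrict (cylinder n τ r))) :
    IntegrableOn g (cylinder n τ r) := by
  have : IsFiniteMeasure ((volume : Measure (ℝ × E n)).restrict (cylinder n τ r)) :=
    ⟨by simpa using volume_cylinder_lt_top τ r⟩
  exact hg.integrable (by simpa using hp)

theorem integrableOn_norm_rpow_of_memLp {V : Type*} [NormedAddCommGroup V] {Q : Set (ℝ × E n)}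
    {p : ℝ} (hp : 0 < p) {g : ℝ × E n → V}
    (hg : MemLp g (ENNReal.ofReal p) (volume.restrict Q)) :
    IntegrableOn (fun y => ‖g y‖ ^ p) Q := by
  have := hg.integrable_norm_rpow (by simpa using hp) (by simp)
  rwa [ENNReal.toReal_ofReal hp.le] at this

theorem SourceBound.integral_rpow_le {Λ m : ℝ} (hΛ : 0 < Λ) (hm : 0 < m) {Q : Set (ℝ × E n)}
    {f : ℝ × E n → ℝ} (hf : SourceBound Λ m Q f) : ∫ y in Q, |f y| ^ m ≤ Λ ^ m := by
  have h := hf.2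
  rw [hf.1.eLpNorm_eq_integral_rpow_norm (by simpa using hm) (by simp),
    ENNReal.toReal_ofReal hm.le, ENNReal.ofReal_le_ofReal_iff hΛ.le] at h
  simp only [Real.norm_eq_abs] at h
  have h0 : 0 ≤ ∫ y in Q, |f y| ^ m := integral_nonneg fun y => by positivity
  calc ∫ y in Q, |f y| ^ m = ((∫ y in Q, |f y| ^ m) ^ m⁻¹) ^ m := by
        rw [← Real.rpow_mul h0, inv_mul_cancel₀ hm.ne', Real.rpow_one]
    _ ≤ Λ ^ m := by gcongr

/-- Mollification does not increase the integrals of a source over small sets. -/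
theorem setIntegral_mollify_le (ρ : ContDiffBump (0 : ℝ × E n)) {Q S : Set (ℝ × E n)}
    (hQ : MeasurableSet Q) {Λ m : ℝ} (hΛ : 0 < Λ) (hm : 1 < m) {f : ℝ × E n → ℝ}
    (hf : SourceBound Λ m Q f) (hfi : IntegrableOn f Q) (hS : volume S ≠ ⊤) :
    ∫ z in S, mollify ρ volume (fun y => |Q.indicator f y|) z ≤
      Λ * volume.real S ^ (1 - 1 / m) := by
  have hm0 : 0 < m := by linarith
  have hfi' : Integrable (Q.indicator f) := (integrable_indicator_iff hQ).2 hfi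
  have hfe : (fun y => |Q.indicator f y| ^ m) = Q.indicator fun y => |f y| ^ m := by
    funext y
    by_cases hy : y ∈ Q
    · simp [hy]
    · simp [hy, Real.zero_rpow hm0.ne']
  have hfm : Integrable fun y => |Q.indicator f y| ^ m := by
    rw [hfe]
    exact (integrable_indicator_iff hQ).2 (integrableOn_norm_rpow_of_memLp hm0 hf.1)
  set g := mollify ρ volume fun y => |Q.indicator f y| with hg
  have hgc : Continuous g := (contDiff_mollify ρ hfi'.norm.locallyIntegrable).continuous
  have hg0 : ∀ z, 0 ≤ g z := mollify_nonneg ρ fun y => abs_nonneg _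
  have hle : ∀ z, g z ^ m ≤ mollify ρ volume (fun y => |Q.indicator f y| ^ m) z :=
    mollify_rpow_le ρ hm.le (fun y => abs_nonneg _) hfi'.norm.locallyIntegrable
      hfm.locallyIntegrable
  have hgm : Integrable fun z => g z ^ m := by
    refine (integrable_mollify ρ hfm).mono'
      (hgc.rpow_const fun _ => Or.inr hm0.le).aestronglyMeasurable
      (Filter.Eventually.of_forall fun z => ?_)
    rw [Real.norm_of_nonneg (Real.rpow_nonneg (hg0 z) m)]
    exact hle z
  -- Jensen holds pointwise, and mollification preserves the integral of `|f| ^ m`.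
  have hbound : ∫ z in S, g z ^ m ≤ Λ ^ m := by
    calc ∫ z in S, g z ^ m ≤ ∫ z, g z ^ m := setIntegral_le_integral hgm
          (Filter.Eventually.of_forall fun z => Real.rpow_nonneg (hg0 z) m)
      _ ≤ ∫ z, mollify ρ volume (fun y => |Q.indicator f y| ^ m) z :=
          integral_mono hgm (integrable_mollify ρ hfm) hle
      _ = ∫ y in Q, |f y| ^ m := by rw [integral_mollify ρ hfm, hfe, integral_indicator hQ]
      _ ≤ Λ ^ m := hf.integral_rpow_le hΛ hm0
  refine (setIntegral_le_rpow_mul_rpow hS hm hg0 hgc.aestronglyMeasurable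
    hgm.integrableOn).trans ?_
  refine mul_le_mul_of_nonneg_right ?_ (by positivity)
  calc (∫ z in S, g z ^ m) ^ (1 / m) ≤ (Λ ^ m) ^ (1 / m) :=
        Real.rpow_le_rpow (integral_nonneg fun z => Real.rpow_nonneg (hg0 z) m) hbound
          (by positivity)
    _ = Λ := by rw [← Real.rpow_mul hΛ.le, mul_one_div_cancel hm0.ne', Real.rpow_one]

theorem integrableOn_matAct {Λ : ℝ} {Q : Set (ℝ × E n)} {A : ℝ × E n → Matrix (Fin n) (Fin n) ℝ}
    (hA : MatrixBound Λ Q A) {Du : ℝ × E n → E n} (hDu : IntegrableOn Du Q) :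
    IntegrableOn (fun y => matAct (A y) (Du y)) Q := by
  have hmeas : AEStronglyMeasurable (fun y => matAct (A y) (Du y)) (volume.restrict Q) :=
    continuous_matAct.comp_aestronglyMeasurable (f := fun y => (A y, Du y))
      (hA.1.prodMk hDu.aestronglyMeasurable)
  refine (hDu.norm.const_mul Λ).mono' hmeas ?_
  filter_upwards [hA.2] with y hy
  exact ((matAct (A y)).le_opNorm _).trans (by gcongr)

theorem norm_mollify_matAct_le (ρ : ContDiffBump (0 : ℝ × E n)) {Λ : ℝ} {Q : Set (ℝ × E n)}
    (hQ : MeasurableSet Q) {A : ℝ × E n → Matrix (Fin n) (Fin n) ℝ}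
    (hA : MatrixBound Λ Q A) {Du : ℝ × E n → E n} (hDu : IntegrableOn Du Q) (z : ℝ × E n) :
    ‖mollify ρ volume (Q.indicator fun y => matAct (A y) (Du y)) z‖ ≤
      Λ * mollify ρ volume (fun y => ‖Q.indicator Du y‖) z := by
  have hDi : Integrable (Q.indicator Du) := (integrable_indicator_iff hQ).2 hDu
  have hVi : Integrable (Q.indicator fun y => matAct (A y) (Du y)) :=
    (integrable_indicator_iff hQ).2 (integrableOn_matAct hA hDu)
  refine (norm_mollify_le ρ _ z).trans ?_
  have h : mollify ρ volume (fun y => Λ * ‖Q.indicator Du y‖) z =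
      Λ * mollify ρ volume (fun y => ‖Q.indicator Du y‖) z := by
    rw [mollify_apply, mollify_apply, ← integral_const_mul]
    simp only [smul_eq_mul, mul_left_comm]
  rw [← h]
  refine mollify_mono ρ hVi.norm.locallyIntegrable (hDi.norm.const_mul Λ).locallyIntegrable ?_ z
  filter_upwards [(ae_restrict_iff' hQ).1 hA.2] with y hy
  by_cases hyQ : y ∈ Q
  · simp only [indicator_of_mem hyQ]
    exact ((matAct (A y)).le_opNorm _).trans (by gcongr; exact hy hyQ)
  · simp [indicator_of_notMem hyQ]

/-! ### Reduction to regular subsolutions. -/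

/-- Mollifications of subsolutions, lowered by the barrier, are regular subsolutions. -/
theorem exists_isRegularSubsolution (n : ℕ) {Λ p m : ℝ} (hΛ : 0 < Λ) (hp : 2 < p) (hm : 1 < m) :
    ∃ l K : ℝ, 0 < l ∧ 0 < K ∧
      ∀ (A : ℝ × E n → Matrix (Fin n) (Fin n) ℝ) (f u : ℝ × E n → ℝ),
        MatrixBound Λ (cylinder n 2 2) A → SourceBound Λ m (cylinder n 2 2) f →
        SolvesInequality Λ p (cylinder n 2 2) A f u →
        (∀ᵐ z ∂(volume.restrict (cylinder n 2 2)), u z ≤ 1) →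
        ∀ ρ : ContDiffBump (0 : ℝ × E n), ρ.rOut < 1 / 4 →
          ∃ (h F : ℝ × E n → ℝ) (G : ℝ × E n → E n),
            IsRegularSubsolution (-2 * ρ.rOut) l K p m
              (fun z => mollify ρ volume ((cylinder n 2 2).indicator u) z - barrier z) h F G := by
  obtain ⟨b, hb, hbar⟩ := exists_norm_fderiv_barrier_le n
  set V₀ := volume.real (Icc (-(3 / 2) : ℝ) (3 / 2) ×ˢ closedBall (0 : E n) (3 / 2)) with hV₀
  have hp0 : 0 < p := by linarith
  have hm0 : 0 < m := by linarith
  -- The cost of the barrier, carried as a constant source: `b` for its time derivative, the other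
  -- term for its gradient inside the Hamiltonian.
  set C := b + Λ⁻¹ * b ^ p with hC
  have hC0 : 0 < C := by positivity
  clear_value C
  have hV₀0 : 0 ≤ V₀ := measureReal_nonneg
  -- The factor `2 ^ (1 - p)` comes from splitting `(h₀ + b) ^ p` by convexity. In `K`, `Λ` serves
  -- the flux and `f`, while `C * (1 + V₀)` serves the constant source.
  refine ⟨Λ⁻¹ * (2 ^ (p - 1))⁻¹, Λ + C * (1 + V₀), by positivity, by positivity, ?_⟩
  intro A f u hA hf ⟨hup, Du, hgrad, hDp, hs⟩ hu1 ρ hρ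
  set Q := cylinder n 2 2 with hQdef
  have hQ : MeasurableSet Q := measurableSet_cylinder 2 2
  have hu : IntegrableOn u Q := integrableOn_of_memLp (by linarith) hup
  have hDu : IntegrableOn Du Q := integrableOn_of_memLp (by linarith) hDp
  have hfi : IntegrableOn f Q := integrableOn_of_memLp hm.le hf.1
  have hDi : Integrable (Q.indicator Du) := (integrable_indicator_iff hQ).2 hDu
  have hui : Integrable (Q.indicator u) := (integrable_indicator_iff hQ).2 hu
  have hfi' : Integrable (Q.indicator f) := (integrable_indicator_iff hQ).2 hfi
  have hV := integrableOn_matAct hA hDu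
  have hVi : Integrable (Q.indicator fun y => matAct (A y) (Du y)) :=
    (integrable_indicator_iff hQ).2 hV
  set U := mollify ρ volume (Q.indicator u) with hU
  set h₀ := mollify ρ volume (fun y => ‖Q.indicator Du y‖) with hh₀
  set F₀ := mollify ρ volume (fun y => |Q.indicator f y|) with hF₀
  have hUc : ContDiff ℝ 1 U := contDiff_mollify ρ hui.locallyIntegrable
  have hh₀c : Continuous h₀ := (contDiff_mollify ρ hDi.norm.locallyIntegrable).continuous
  have hF₀c : Continuous F₀ := (contDiff_mollify ρ hfi'.norm.locallyIntegrable).continuous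
  have hh₀0 : ∀ z, 0 ≤ h₀ z := mollify_nonneg ρ fun y => norm_nonneg _
  have hF₀0 : ∀ z, 0 ≤ F₀ z := mollify_nonneg ρ fun y => abs_nonneg _
  have hU1 : ∀ z, U z ≤ 1 := fun z => by
    rw [← mollify_const ρ (μ := volume) (1 : ℝ) z]
    refine mollify_mono ρ hui.locallyIntegrable (locallyIntegrable_const 1) ?_ z
    filter_upwards [(ae_restrict_iff' hQ).1 hu1] with y hy
    by_cases hyQ : y ∈ Q
    · simpa [hyQ] using hy hyQ
    · simp [hyQ]
  have hpos_box : ∀ z, 0 < U z - barrier z →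
      z ∈ Icc (-(3 / 2) : ℝ) (3 / 2) ×ˢ closedBall (0 : E n) (3 / 2) := by
    intro z hz
    have h1 := hU1 z
    refine ⟨abs_le.1 ?_, mem_closedBall_zero_iff.2 ?_⟩
    · by_contra! h
      linarith [one_le_barrier_of_time h.le]
    · by_contra! h
      linarith [one_le_barrier_of_space h.le]
  have hball : ∀ z : ℝ × E n, z.1 ≤ -2 * ρ.rOut → 0 < U z - barrier z →
      closedBall z ρ.rOut ⊆ interior Q := fun z ht hz =>
    closedBall_subset_interior_cylinder hρ ρ.rOut_pos (hpos_box z hz).1.1 ht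
      (mem_closedBall_zero_iff.1 (hpos_box z hz).2)
  have hfd : ∀ z w, fderiv ℝ (fun z => U z - barrier z) z w =
      fderiv ℝ U z w - fderiv ℝ barrier z w := by
    intro z w
    rw [fderiv_fun_sub (hUc.differentiable one_ne_zero z)
      (contDiff_barrier.differentiable one_ne_zero z)]
    rfl
  refine ⟨fun z => h₀ z + b, fun z => F₀ z + C,
    mollify ρ volume (Q.indicator fun y => matAct (A y) (Du y)), ?_⟩
  refine
    { contDiff := hUc.sub contDiff_barrier
      contDiff_flux := contDiff_mollify ρ hVi.locallyIntegrable
      continuous_grad := hh₀c.add continuous_const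
      continuous_source := hF₀c.add continuous_const
      grad_nonneg := fun z => add_nonneg (hh₀0 z) hb.le
      source_nonneg := fun z => add_nonneg (hF₀0 z) hC0.le
      le_one := fun z => by linarith [hU1 z, barrier_nonneg z]
      nonpos_of_time := fun z hz => by linarith [hU1 z, one_le_barrier_of_time hz]
      nonpos_of_space := fun z hz => by linarith [hU1 z, one_le_barrier_of_space hz]
      inequality := ?_
      spaceDeriv_le := ?_
      flux_le := ?_
      source_le := ?_ }
  · intro z ht hz
    have h1 := mollify_inequality ρ hQ hΛ hp hu hDu
      (integrableOn_norm_rpow_of_memLp hp0 hDp) hV hfi hs (hball z ht hz)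
    have h2 : |fderiv ℝ (barrier (n := n)) z (1, 0)| ≤ b := by
      have := (fderiv ℝ (barrier (n := n)) z).le_of_opNorm_le (hbar z (hpos_box z hz)) (1, 0)
      simpa [Prod.norm_def] using this
    have h3 : (h₀ z + b) ^ p ≤ 2 ^ (p - 1) * (h₀ z ^ p + b ^ p) := by
      have := (convexOn_rpow (by linarith : 1 ≤ p)).2
        (mem_Ici.2 (by linarith [hh₀0 z] : 0 ≤ 2 * h₀ z)) (mem_Ici.2 (by linarith : 0 ≤ 2 * b))
        (by norm_num : (0 : ℝ) ≤ 1 / 2) (by norm_num : (0 : ℝ) ≤ 1 / 2) (by norm_num)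
      simp only [smul_eq_mul] at this
      rw [Real.mul_rpow (by norm_num) (hh₀0 z), Real.mul_rpow (by norm_num) hb.le] at this
      have e : (2 : ℝ) ^ p = 2 * 2 ^ (p - 1) := by
        rw [Real.rpow_sub_one (by norm_num)]; ring
      rw [e] at this
      calc (h₀ z + b) ^ p = (1 / 2 * (2 * h₀ z) + 1 / 2 * (2 * b)) ^ p := by ring_nf
        _ ≤ _ := this
        _ = _ := by ring
    have h4 : Λ⁻¹ * (2 ^ (p - 1))⁻¹ * (h₀ z + b) ^ p ≤ Λ⁻¹ * h₀ z ^ p + Λ⁻¹ * b ^ p := by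
      calc Λ⁻¹ * (2 ^ (p - 1))⁻¹ * (h₀ z + b) ^ p
          ≤ Λ⁻¹ * (2 ^ (p - 1))⁻¹ * (2 ^ (p - 1) * (h₀ z ^ p + b ^ p)) := by gcongr
        _ = _ := by field_simp
    have h5 := (neg_le_abs _).trans h2
    simp only [timeDeriv] at h1
    simp only [timeDeriv, hfd]
    linarith
  · intro z ht hz e
    have h1 := spaceDeriv_mollify_le ρ hQ hu hDu hgrad (hball z ht hz) e
    have h2 : |fderiv ℝ (barrier (n := n)) z (0, e)| ≤ b * ‖e‖ := by
      have := (fderiv ℝ (barrier (n := n)) z).le_of_opNorm_le (hbar z (hpos_box z hz)) (0, e)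
      simpa [Prod.norm_def] using this
    simp only [spaceDeriv, hfd]
    refine (abs_sub _ _).trans ?_
    rw [add_mul]
    exact add_le_add h1 h2
  · intro z ht hz
    refine (norm_mollify_matAct_le ρ hQ hA hDu z).trans ?_
    have : 0 ≤ C * (1 + V₀) := by positivity
    have := hh₀0 z
    gcongr
    · linarith
    · linarith
  · intro S hS hSsub
    have hSbox : S ⊆ Icc (-(3 / 2) : ℝ) (3 / 2) ×ˢ closedBall (0 : E n) (3 / 2) :=
      fun z hz => hpos_box z (hSsub hz).2
    have hboxc : IsCompact (Icc (-(3 / 2) : ℝ) (3 / 2) ×ˢ closedBall (0 : E n) (3 / 2)) :=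
      isCompact_Icc.prod (isCompact_closedBall _ _)
    have hSfin : volume S ≠ ⊤ := ((measure_mono hSbox).trans_lt hboxc.measure_lt_top).ne
    have hSV : volume.real S ≤ V₀ := measureReal_mono hSbox hboxc.measure_lt_top.ne
    rw [integral_add (hF₀c.continuousOn.integrableOn_compact hboxc |>.mono_set hSbox)
      (integrableOn_const hSfin)]
    have h1 := setIntegral_mollify_le ρ hQ hΛ hm hf hfi hSfin
    -- Confinement to the box puts the constant source in the same form as an `L^m` source.
    have h2 : volume.real S ≤ (1 + V₀) * volume.real S ^ (1 - 1 / m) := by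
      have h0 : 0 ≤ volume.real S := measureReal_nonneg
      have hm1 : 1 / m ≤ 1 := by rw [div_le_one hm0]; exact hm.le
      calc volume.real S = volume.real S ^ (1 / m) * volume.real S ^ (1 - 1 / m) := by
            rw [← Real.rpow_add' h0 (by norm_num)]; norm_num
        _ ≤ (1 + V₀) * volume.real S ^ (1 - 1 / m) := by
            gcongr
            calc volume.real S ^ (1 / m) ≤ (1 + V₀) ^ (1 / m) := by gcongr; linarith
              _ ≤ (1 + V₀) ^ (1 : ℝ) :=
                Real.rpow_le_rpow_of_exponent_le (by linarith) hm1
              _ = 1 + V₀ := Real.rpow_one _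
    have h3 : ∫ z in S, C = C * volume.real S := by simp [mul_comm]
    rw [h3, add_mul, mul_assoc C]
    exact add_le_add h1 (by gcongr)

/-- Since the barrier is at least `1 / 10`, the mollified positive part of `u` is at least `1 / 10`
on the superlevel set. Its integral is at most `δ`, because `u ≤ 1`, so Markov's inequality gives
the factor `10`. -/
theorem measureReal_superlevel_mollify_le (ρ : ContDiffBump (0 : ℝ × E n)) {Q : Set (ℝ × E n)}
    (hQ : MeasurableSet Q) {u : ℝ × E n → ℝ} (hu : IntegrableOn u Q)
    (hu1 : ∀ᵐ z ∂(volume.restrict Q), u z ≤ 1) {δ : ℝ} (hδ : 0 ≤ δ)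
    (hsmall : volume ({z | 0 < u z} ∩ Q) ≤ ENNReal.ofReal δ) (T : ℝ) :
    volume.real (superlevel T (fun z => mollify ρ volume (Q.indicator u) z - barrier z) 0) ≤
      10 * δ := by
  have hui : Integrable (Q.indicator u) := (integrable_indicator_iff hQ).2 hu
  set g : ℝ × E n → ℝ := fun y => max (Q.indicator u y) 0 with hg
  have hgi : Integrable g := hui.pos_part
  have hg0 : ∀ y, 0 ≤ g y := fun y => le_max_right _ _
  have hgδ : ∫ y, g y ≤ δ := by
    rw [integral_eq_lintegral_of_nonneg_ae (Filter.Eventually.of_forall hg0)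
      hgi.aestronglyMeasurable]
    refine ENNReal.toReal_le_of_le_ofReal hδ (le_trans ?_ hsmall)
    calc ∫⁻ y, ENNReal.ofReal (g y)
        ≤ ∫⁻ y, ({z | 0 < u z} ∩ Q).indicator (fun _ => (1 : ℝ≥0∞)) y := by
          refine lintegral_mono_ae ?_
          filter_upwards [(ae_restrict_iff' hQ).1 hu1] with y hy
          by_cases hyS : y ∈ {z | 0 < u z} ∩ Q
          · rw [indicator_of_mem hyS]
            simp only [hg, indicator_of_mem hyS.2]
            exact ENNReal.ofReal_le_one.2 (max_le (hy hyS.2) zero_le_one)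
          · have : g y = 0 := by
              refine max_eq_right ?_
              by_cases hyQ : y ∈ Q
              · rw [indicator_of_mem hyQ]
                exact not_lt.1 fun h => hyS ⟨h, hyQ⟩
              · rw [indicator_of_notMem hyQ]
            simp [this]
      _ ≤ 1 * volume ({z | 0 < u z} ∩ Q) := lintegral_indicator_const_le _ _
      _ = _ := one_mul _
  have hmg := integrable_mollify ρ hgi
  have hmark := mul_meas_ge_le_integral_of_nonneg
    (Filter.Eventually.of_forall (mollify_nonneg ρ (μ := volume) hg0)) hmg (1 / 10)
  rw [integral_mollify ρ hgi] at hmark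
  have hsub : superlevel T (fun z => mollify ρ volume (Q.indicator u) z - barrier z) 0 ⊆
      {z | 1 / 10 ≤ mollify ρ volume g z} := by
    intro z hz
    have h1 := hz.2
    have h2 := mollify_mono ρ hui.locallyIntegrable hgi.locallyIntegrable
      (Filter.Eventually.of_forall fun y => le_max_left _ _) z
    have h3 : 1 / 10 ≤ barrier z := by
      have : (0 : ℝ) ≤ z.1 ^ 6 := by positivity
      have : (0 : ℝ) ≤ (‖z.2‖ ^ 2) ^ 3 := by positivity
      unfold barrier
      linarith
    change 1 / 10 ≤ mollify ρ volume g z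
    linarith
  have := measureReal_mono hsub (hmg.measure_ge_lt_top (by norm_num)).ne
  linarith

end SuperquadraticHJ

end

/-! ### Conclusion by removing the mollification. -/

theorem proposition3p1 (n : ℕ) (hn : 1 ≤ n) (Λ p m : ℝ) (hΛ : 0 < Λ) (hp : 2 < p)
    (hm : 1 + max (n : ℝ) 2 / p < m) :
    ∃ δ₀ : ℝ, 0 < δ₀ ∧
      ∀ (A : ℝ × SuperquadraticHJ.E n → Matrix (Fin n) (Fin n) ℝ)
        (f u : ℝ × SuperquadraticHJ.E n → ℝ),
        SuperquadraticHJ.MatrixBound Λ (SuperquadraticHJ.cylinder n 2 2) A →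
        SuperquadraticHJ.SourceBound Λ m (SuperquadraticHJ.cylinder n 2 2) f →
        SuperquadraticHJ.SolvesInequality Λ p (SuperquadraticHJ.cylinder n 2 2) A f u →
        (∀ᵐ z ∂(volume.restrict (SuperquadraticHJ.cylinder n 2 2)), u z ≤ 1) →
        volume ({z | 0 < u z} ∩ SuperquadraticHJ.cylinder n 2 2) ≤ ENNReal.ofReal δ₀ →
        ∀ᵐ z ∂(volume.restrict (SuperquadraticHJ.cylinder n 1 1)), u z ≤ 1 / 2 := by
  have hm1 : 1 < m := by
    have : 0 < max (n : ℝ) 2 / p := div_pos (lt_max_of_lt_right two_pos) (by linarith)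
    linarith
  obtain ⟨l, K, hl, hK, hreg⟩ :=
    SuperquadraticHJ.exists_isRegularSubsolution n (m := m) hΛ hp hm1
  obtain ⟨δ, hδ, hDG⟩ :=
    SuperquadraticHJ.exists_le_of_measureReal_superlevel_le hn hl hK hp hm
  refine ⟨δ / 10, by positivity, fun A f u hA hf hs hu1 hsmall => ?_⟩
  have hQ := SuperquadraticHJ.measurableSet_cylinder (n := n) 2 2
  have hu := SuperquadraticHJ.integrableOn_of_memLp (by linarith) hs.1
  let ρ : ℕ → ContDiffBump (0 : ℝ × SuperquadraticHJ.E n) := fun j =>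
    { rIn := 1 / ((j : ℝ) + 1) / 10
      rOut := 2 * (1 / ((j : ℝ) + 1) / 10)
      rIn_pos := by positivity
      rIn_lt_rOut := by
        have : 0 < 1 / ((j : ℝ) + 1) / 10 := by positivity
        linarith }
  have hρ4 : ∀ j, (ρ j).rOut < 1 / 4 := fun j => by
    have : 1 / ((j : ℝ) + 1) ≤ 1 := by
      rw [div_le_one (by positivity)]
      linarith [Nat.cast_nonneg (α := ℝ) j]
    change 2 * (1 / ((j : ℝ) + 1) / 10) < 1 / 4
    linarith
  have hρlim : Filter.Tendsto (fun j => (ρ j).rOut) Filter.atTop (nhds 0) := by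
    have := ((tendsto_one_div_add_atTop_nhds_zero_nat (𝕜 := ℝ)).div_const 10).const_mul 2
    rw [zero_div, mul_zero] at this
    exact this
  -- Lebesgue differentiation needs a bounded ratio of outer to inner radius, here exactly `2`.
  have hae := ContDiffBump.ae_convolution_tendsto_right_of_locallyIntegrable (μ := volume)
    (K := 2) hρlim (Filter.Eventually.of_forall fun j => le_rfl)
    ((integrable_indicator_iff hQ).2 hu).locallyIntegrable
  -- Estimates for the mollified functions hold only before time `-2 * (ρ j).rOut`. This reaches
  -- every negative time as `j` grows, but not the null slice at time zero.
  have hneg : ∀ᵐ z : ℝ × SuperquadraticHJ.E n, z.1 ≠ 0 := by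
    have h0 : volume ({0} ×ˢ univ : Set (ℝ × SuperquadraticHJ.E n)) = 0 := by
      rw [Measure.volume_eq_prod, Measure.prod_prod]
      simp
    refine measure_mono_null (fun z hz => ?_) h0
    exact ⟨by simpa using hz, mem_univ _⟩
  rw [ae_restrict_iff' (SuperquadraticHJ.measurableSet_cylinder 1 1)]
  filter_upwards [hae, hneg] with z hz hz0 hzQ
  have hzt : z.1 < 0 := lt_of_le_of_ne hzQ.1.2 hz0
  have hzQ2 : z ∈ SuperquadraticHJ.cylinder n 2 2 :=
    ⟨⟨by linarith [hzQ.1.1], hzQ.1.2⟩, ball_subset_ball one_le_two hzQ.2⟩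
  rw [indicator_of_mem hzQ2] at hz
  refine le_of_tendsto hz ?_
  have hev : ∀ᶠ j in Filter.atTop, (ρ j).rOut < -z.1 / 2 :=
    hρlim.eventually (gt_mem_nhds (by linarith))
  filter_upwards [hev] with j hj
  obtain ⟨h, F, G, H⟩ := hreg A f u hA hf hs hu1 (ρ j) (hρ4 j)
  have hlev := SuperquadraticHJ.measureReal_superlevel_mollify_le (ρ j) hQ hu hu1
    (by positivity) hsmall (-2 * (ρ j).rOut)
  have := hDG _ _ h F G H (by linarith) z (by linarith)
  have hb := SuperquadraticHJ.barrier_le hzQ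
  change SuperquadraticHJ.mollify (ρ j) volume _ z ≤ 1 / 2
  linarith
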